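/- Let $\mathbb D$ be the open unit disc, let $a\in\mathbb R$, put $b=b(a)=\frac{1-ia}{1+ia}$ and $$\phi_a(z)=z\,(z+b)^{-1-b}\qquad(z\in\mathbb D),$$ where $(z+b)^{-1-b}=\exp\big((-1-b)\log(z+b)\big)$ for the holomorphic branch of $\log(z+b)$ in $\mathbb D$ whose value at $z=0$ is the principal logarithm of $b$. Let $\mathrm{Arccot}$ take values in $(0,\pi)$. (1) $\phi_a$ is $\psi$-spirallike with $\psi=\mathrm{Arccot}(a)-\frac{\pi}{2}$; that is, $\phi_a$ is holomorphic and injective in $\mathbb D$, $\phi_a(0)=0$, and $\phi_a(\mathbb D)$ is a simply connected domain containing, with each point $w_0$, the spiral $w_0\exp(-e^{i\psi}t)$, $t\ge 0$. (2) There is a unique continuous function $f_a:\mathbb D\times[0,\infty)\to\mathbb C$, holomorphic in the first variable, that satisfies the radial Loewner equation driven by $e^{iat}$, $$\frac{\partial f_a}{\partial t}(z,t)=-z f_a'(z,t)\,\frac{e^{iat}+z}{e^{iat}-z},\qquad f_a(z,0)=z\qquad(|z|<1,\ t\ge 0).$$ The functions $f_a(\cdot,t)$ are injective maps of $\mathbb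 D$ into $\mathbb D$ with $f_a(0,t)=0$, $f_a'(0,t)>0$ and $f_a(\mathbb D,t)\subseteq f_a(\mathbb D,s)$ for $0\le s\le t$, and $$f_a(z,t)=\phi_a^{-1}\big(e^{(ia-1)t}\phi_a(e^{-iat}z)\big)\qquad(|z|<1,\ t\ge0),$$ where $\phi_a^{-1}:\phi_a(\mathbb D)\to\mathbb D$ and the argument lies in $\phi_a(\mathbb D)$. (3) For each $t\ge0$ the limit $\gamma_a(t)=f_a(e^{iat},t):=\lim_{\mathbb D\ni z\to e^{iat}}f_a(z,t)$ exists. One has $\gamma_a(0)=1$ and $\gamma_a(t)\in\mathbb D$ for $t>0$. The trace $\gamma_a$ is a smooth simple curve: it is injective on $[0,\infty)$, $C^\infty$ with non-vanishing derivative on $(0,\infty)$, and $s\mapsto\gamma_a(s^2)$ is $C^\infty$ on $[0,\infty)$ with non-zero derivative at $0$. It starts perpendicularly to the unit circle at $1$: $\mathrm{Arg}(1-\gamma_a(t))\to0$ and $\gamma_a'(t)/|\gamma_a'(t)|\to-1$ as $t\to0^+$. Further, $\gamma_a(t)=r(t)e^{i\Theta(t)}$ with continuous $r>0$ and $\Theta$,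 $\Theta(0)=0$, where $r$ decreases strictly to $0$ as $t\to\infty$. If $a\ne0$ the trace spirals about the origin: $\Theta$ increases strictly to $+\infty$ if $a>0$, and decreases strictly to $-\infty$ if $a<0$. If $a=0$, then $\Theta\equiv0$. (4) $\gamma_{-a}(t)=\overline{\gamma_a(t)}$ for all $t\ge0$; thus the traces for $a$ and $-a$ are reflections of each other in the real line. -/

import Mathlib

open Set Filter Topology

namespace Spiroid

/-- The open unit disc. -/
def disc : Set ℂ := Metric.ball (0 : ℂ) 1

/-! ### The radial Loewner equation -/

/-- `f` solves the radial Loewner equation driven by the unimodular function `ζ` (a unit point mass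
at `ζ t` at each time `t`), with the identity as initial value:
`∂f/∂t (z,t) = - z f'(z,t) (ζ t + z) / (ζ t - z)` for `|z| < 1`, `t ≥ 0`, and `f(z,0) = z`.
Each `f(·,t)` is holomorphic in the disc and the family is continuous; the time derivative at
`t = 0` is one-sided. Only the values on `disc × [0,∞)` matter. -/
structure IsLoewnerFlow (ζ : ℝ → ℂ) (f : ℂ → ℝ → ℂ) : Prop where
  continuousOn : ContinuousOn (fun p : ℂ × ℝ => f p.1 p.2) (disc ×ˢ Ici (0 : ℝ))
  holomorphic : ∀ t : ℝ, 0 ≤ t → DifferentiableOn ℂ (fun z => f z t) disc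
  initial : ∀ z ∈ disc, f z 0 = z
  equation : ∀ z ∈ disc, ∀ t : ℝ, 0 ≤ t →
    HasDerivWithinAt (fun s : ℝ => f z s)
      (-(z * deriv (fun w => f w t) z * ((ζ t + z) / (ζ t - z)))) (Ici 0) t

/-- `f(·,t)`, `t ≥ 0`, are the normalized Riemann maps (`f(0,t) = 0`, `f'(0,t) > 0`) of a
decreasing family of domains in the disc. -/
structure IsDecreasingChain (f : ℂ → ℝ → ℂ) : Prop where
  holomorphic : ∀ t : ℝ, 0 ≤ t → DifferentiableOn ℂ (fun z => f z t) disc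
  univalent : ∀ t : ℝ, 0 ≤ t → InjOn (fun z => f z t) disc
  mapsTo : ∀ t : ℝ, 0 ≤ t → MapsTo (fun z => f z t) disc disc
  map_zero : ∀ t : ℝ, 0 ≤ t → f 0 t = 0
  deriv_zero_pos : ∀ t : ℝ, 0 ≤ t → ∃ β : ℝ, 0 < β ∧ deriv (fun z => f z t) 0 = (β : ℂ)
  decreasing : ∀ s t : ℝ, 0 ≤ s → s ≤ t → (fun z => f z t) '' disc ⊆ (fun z => f z s) '' disc

/-- `γ` parameterizes the trace `t ↦ f(ζ t, t)`, `t ≥ 0`, of the flow, where `f(·,t)` is evaluated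
at the boundary point `ζ t` by continuous extension from the disc. -/
def IsTrace (ζ : ℝ → ℂ) (f : ℂ → ℝ → ℂ) (γ : ℝ → ℂ) : Prop :=
  ∀ t : ℝ, 0 ≤ t → Tendsto (fun z => f z t) (𝓝[disc] (ζ t)) (𝓝 (γ t))

/-- The driving function `t ↦ e^{iat}`. -/
noncomputable def driving (a : ℝ) (t : ℝ) : ℂ := Complex.exp (Complex.I * a * t)

/-! ### Spirallike functions -/

/-- A simply connected domain containing `0` that contains, with each point `w₀`, the logarithmic
spiral `w₀ exp(-e^{iψ} t)`, `0 ≤ t < ∞`, joining `w₀` to the origin. -/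
structure IsSpirallikeDomain (ψ : ℝ) (D : Set ℂ) : Prop where
  isOpen : IsOpen D
  simplyConnected : IsSimplyConnected D
  zero_mem : (0 : ℂ) ∈ D
  spiral_mem : ∀ w ∈ D, ∀ t : ℝ, 0 ≤ t →
    w * Complex.exp (-(Complex.exp (Complex.I * ψ) * t)) ∈ D

/-- A univalent function of the disc, vanishing at `0`, onto a `ψ`-spirallike domain. -/
structure IsSpirallike (ψ : ℝ) (φ : ℂ → ℂ) : Prop where
  holomorphic : DifferentiableOn ℂ φ disc
  univalent : InjOn φ disc
  map_zero : φ 0 = 0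
  image : IsSpirallikeDomain ψ (φ '' disc)

/-- The inverse cotangent with values in `(0, π)`. -/
noncomputable def arccot (x : ℝ) : ℝ := Real.pi / 2 - Real.arctan x

theorem arccot_mem (x : ℝ) : arccot x ∈ Ioo 0 Real.pi := by
  have h1 := Real.arctan_lt_pi_div_two x
  have h2 := Real.neg_pi_div_two_lt_arctan x
  constructor <;> unfold arccot <;> linarith

theorem cot_arccot (x : ℝ) : Real.cot (arccot x) = x := by
  rw [Real.cot_eq_cos_div_sin, arccot, Real.cos_pi_div_two_sub, Real.sin_pi_div_two_sub,
    ← Real.tan_eq_sin_div_cos, Real.tan_arctan]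

/-! ### The function `φ_a` -/

/-- `b(a) = (1 - ia) / (1 + ia)`, a point of the unit circle other than `-1`. -/
noncomputable def b (a : ℝ) : ℂ := (1 - Complex.I * a) / (1 + Complex.I * a)

/-- The holomorphic branch in the disc of `log (z + b)` whose value at `0` is the principal
logarithm of `b`. -/
noncomputable def logBranch (a : ℝ) (z : ℂ) : ℂ :=
  Complex.log (b a) + Complex.log (1 + z / b a)

/-- `φ_a(z) = z (z + b)^{-1-b}`, the power being `exp((-1-b) log(z + b))` for the branch above. -/
noncomputable def phi (a : ℝ) (z : ℂ) : ℂ :=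
  z * Complex.exp ((-1 - b a) * logBranch a z)

theorem norm_b (a : ℝ) : ‖b a‖ = 1 := by
  have h : (1 - Complex.I * a : ℂ) = (starRingEnd ℂ) (1 + Complex.I * a) := by
    simp [sub_eq_add_neg]
  have h0 : (1 + Complex.I * a : ℂ) ≠ 0 := by
    intro h
    have := congrArg Complex.re h
    simp at this
  rw [b, h, norm_div, RCLike.norm_conj, div_self (norm_ne_zero_iff.mpr h0)]

theorem b_ne_zero (a : ℝ) : b a ≠ 0 := by
  rw [← norm_ne_zero_iff, norm_b]; exact one_ne_zero

theorem one_add_div_b_mem (a : ℝ) {z : ℂ} (hz : z ∈ disc) : 1 + z / b a ∈ Complex.slitPlane := by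
  refine Or.inl ?_
  have h1 : ‖z / b a‖ < 1 := by
    rw [norm_div, norm_b, div_one]
    simpa [disc] using hz
  have h2 := (abs_lt.mp ((Complex.abs_re_le_norm (z / b a)).trans_lt h1)).1
  simp only [Complex.add_re, Complex.one_re]
  linarith

/-- `logBranch a` is a logarithm of `z + b`. -/
theorem exp_logBranch (a : ℝ) {z : ℂ} (hz : z ∈ disc) :
    Complex.exp (logBranch a z) = z + b a := by
  rw [logBranch, Complex.exp_add, Complex.exp_log (b_ne_zero a),
    Complex.exp_log (Complex.slitPlane_ne_zero (one_add_div_b_mem a hz)), mul_add,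
    mul_div_cancel₀ _ (b_ne_zero a)]
  ring

theorem differentiableOn_logBranch (a : ℝ) : DifferentiableOn ℂ (logBranch a) disc := by
  intro z hz
  apply DifferentiableAt.differentiableWithinAt
  unfold logBranch
  exact (differentiableAt_const _).add
    (((differentiableAt_const _).add (differentiableAt_id.div_const _)).clog
      (one_add_div_b_mem a hz))

/-! ### Geometry of the trace -/

/-- `γ : [0,∞) → ℂ` is a smooth simple curve: injective, smooth and regular for `t > 0`, and
smooth and regular up to and including the initial point after the change of parameter
`t = s²`. -/
structure IsSmoothCurve (γ : ℝ → ℂ) : Prop where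
  injOn : InjOn γ (Ici 0)
  contDiffOn : ContDiffOn ℝ (⊤ : ℕ∞) γ (Ioi 0)
  deriv_ne_zero : ∀ t : ℝ, 0 < t → deriv γ t ≠ 0
  contDiffOn_sq : ContDiffOn ℝ (⊤ : ℕ∞) (fun s : ℝ => γ (s ^ 2)) (Ici 0)
  derivWithin_sq_ne_zero : derivWithin (fun s : ℝ => γ (s ^ 2)) (Ici 0) 0 ≠ 0

/-- `γ` starts at the point `1` of the unit circle, perpendicularly to the circle: both the chord
direction and the unit tangent tend to the inner normal `-1`. -/
structure StartsPerpendicularly (γ : ℝ → ℂ) : Prop where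
  start : γ 0 = 1
  chord : Tendsto (fun t => Complex.arg (1 - γ t)) (𝓝[>] 0) (𝓝 0)
  tangent : Tendsto (fun t => deriv γ t / (‖deriv γ t‖ : ℂ)) (𝓝[>] 0) (𝓝 (-1))

/-- `γ = r e^{iΘ}` on `[0,∞)` with `r > 0` and `Θ` continuous, `Θ 0 = 0`, and `r` strictly
decreasing to zero. -/
structure IsPolarForm (γ : ℝ → ℂ) (r Θ : ℝ → ℝ) : Prop where
  eq : ∀ t : ℝ, 0 ≤ t → γ t = (r t : ℂ) * Complex.exp (Complex.I * Θ t)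
  r_pos : ∀ t : ℝ, 0 ≤ t → 0 < r t
  r_anti : StrictAntiOn r (Ici 0)
  r_tendsto : Tendsto r atTop (𝓝 0)
  r_continuousOn : ContinuousOn r (Ici 0)
  angle_continuousOn : ContinuousOn Θ (Ici 0)
  angle_zero : Θ 0 = 0

end Spiroid

/-!
In the rotating frame `w = e^{-iat} z` the Loewner equation becomes autonomous, and
`w φ_a'(w) / φ_a(w) = (1 - ia) / p(w)` with `p(w) = (1 + w) / (1 - w) - ia`
(`logDeriv_mul_herglotz`) says that `φ_a` conjugates its vector field `-w p(w)` (`spiralField`)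
to the linear field `v ↦ (ia - 1) v`, whose orbits are logarithmic spirals.

*Univalence.* With `w = e^u`, `φ_a = exp ∘ Φ` on the left half-plane, where `Φ' / (1 - ia) = 1 / p`
has positive real part; so `Φ` is injective by the Noshiro–Warschawski criterion, and `φ_a` is
injective in the disc (`injOn_phi`). Since `Re p > 0`, the modulus of the preimage decreases along
the spirals, which therefore cannot leave `φ_a(𝔻)` (`spiral_mem_closedBall`): this is
spirallikeness.

*The flow.* The formula `φ_a⁻¹(e^{(ia-1)t} φ_a(e^{-iat} z))` solves the equation by the chain rule.
Any solution is constant along the characteristics, which are spirals run backwards and stay in the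
disc, whence uniqueness (`IsLoewnerFlow.eq_flow`). The chain rule for a solution that is merely
continuous, holomorphic in `z` and differentiable in `t` rests on the joint continuity of the
`z`-derivative (`hasDerivWithinAt_along`).

*The trace.* It is the lift `γ` through `φ_a` of the spiral `e^{(ia-1)t} φ_a(1)` from `1`. Near the
simple critical point `1` of `φ_a` the map is a square in a suitable coordinate, so `γ(s²)` is
holomorphic in `s` with velocity `-2` at `s = 0` (`exists_tip_lift`); this puts the spiral inside
`φ_a(𝔻)` and gives smoothness and perpendicularity at the start. The explicit shape of `φ_a`
provides a continuous logarithm of `γ` with derivative `-p(γ)` (`traceLog`), so the modulus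
decreases and the angle has derivative `a - Im c` with `c = (1 + γ) / (1 - γ)`. The line `Im c = a`
is a one-way barrier for the field. Orbits starting on the real axis start on the right side of it,
and the trace, being a limit of such orbits, lies on that side, strictly (`mul_angle_deriv_pos`).
Complex conjugation exchanges `φ_a` and `φ_{-a}`, which gives the reflection property and, for
`a = 0`, a real trace.
-/

namespace Spiroid

/-! ### Tools from complex analysis -/

theorem isOpen_disc : IsOpen disc := Metric.isOpen_ball

theorem mem_disc {z : ℂ} : z ∈ disc ↔ ‖z‖ < 1 := by simp [disc]

theorem tendsto_invFunOn {f : ℂ → ℂ} {U : Set ℂ} (hU : IsOpen U)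
    (hf : DifferentiableOn ℂ f U) (hinj : InjOn f U) {w : ℂ} (hw : w ∈ U) (hd : deriv f w ≠ 0) :
    Tendsto (Function.invFunOn f U) (𝓝 (f w)) (𝓝 w) := by
  have hs : HasStrictDerivAt f (deriv f w) w :=
    (hf.analyticAt (hU.mem_nhds hw)).hasStrictDerivAt
  rw [← hs.map_nhds_eq hd, tendsto_map'_iff]
  refine tendsto_id.congr' ?_
  filter_upwards [hU.mem_nhds hw] with z hz
  exact (hinj.leftInvOn_invFunOn hz).symm

theorem isOpen_image_of_deriv_ne_zero {f : ℂ → ℂ} {U : Set ℂ} (hU : IsOpen U)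
    (hf : DifferentiableOn ℂ f U) (hd : ∀ w ∈ U, deriv f w ≠ 0) : IsOpen (f '' U) := by
  rw [isOpen_iff_mem_nhds]
  rintro _ ⟨w, hw, rfl⟩
  have hs : HasStrictDerivAt f (deriv f w) w :=
    (hf.analyticAt (hU.mem_nhds hw)).hasStrictDerivAt
  rw [← hs.map_nhds_eq (hd w hw)]
  exact image_mem_map (hU.mem_nhds hw)

theorem hasDerivAt_invFunOn {f : ℂ → ℂ} {U : Set ℂ} (hU : IsOpen U)
    (hf : DifferentiableOn ℂ f U) (hinj : InjOn f U) (hd : ∀ w ∈ U, deriv f w ≠ 0)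
    {v : ℂ} (hv : v ∈ f '' U) :
    HasDerivAt (Function.invFunOn f U) (deriv f (Function.invFunOn f U v))⁻¹ v := by
  obtain ⟨w, hw, rfl⟩ := hv
  have hw' : Function.invFunOn f U (f w) = w := hinj.leftInvOn_invFunOn hw
  have hc : ContinuousAt (Function.invFunOn f U) (f w) := by
    have := tendsto_invFunOn hU hf hinj hw (hd w hw)
    rwa [ContinuousAt, hw']
  refine HasDerivAt.of_local_left_inverse (f := f) hc ?_ ?_ ?_
  · rw [hw']; exact (hf.differentiableAt (hU.mem_nhds hw)).hasDerivAt
  · rw [hw']; exact hd w hw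
  · filter_upwards [(isOpen_image_of_deriv_ne_zero hU hf hd).mem_nhds (mem_image_of_mem f hw)]
      with y hy
    exact Function.invFunOn_eq hy

/-- The Noshiro–Warschawski criterion: a holomorphic function on a convex set whose derivative,
rotated by the constant `c`, has positive real part is injective. -/
theorem injOn_of_re_deriv_pos {f f' : ℂ → ℂ} {H : Set ℂ} (hH : Convex ℝ H) (c : ℂ)
    (hf : ∀ u ∈ H, HasDerivAt f (f' u) u) (hpos : ∀ u ∈ H, 0 < (c * f' u).re) : InjOn f H := by
  intro u hu v hv huv
  by_contra hne
  have hd : v - u ≠ 0 := sub_ne_zero.mpr (Ne.symm hne)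
  -- Along the segment the real part of `c f / (v - u)` is strictly increasing.
  let q : ℝ → ℝ := fun x => (c / (v - u) * f (u + x * (v - u))).re
  have hmem : ∀ x ∈ Icc (0 : ℝ) 1, u + x * (v - u) ∈ H := fun x hx => by
    have := hH.add_smul_sub_mem hu hv hx
    simpa using this
  have hq : ∀ x ∈ Icc (0 : ℝ) 1, HasDerivAt q (c * f' (u + x * (v - u))).re x := fun x hx => by
    have h1 : HasDerivAt (fun z : ℂ => c / (v - u) * f (u + z * (v - u)))
        (c / (v - u) * (f' (u + x * (v - u)) * (1 * (v - u)))) (x : ℂ) :=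
      (HasDerivAt.comp (x : ℂ) (hf _ (hmem x hx))
        (((hasDerivAt_id (x : ℂ)).mul_const (v - u)).const_add u)).const_mul _
    have h2 := h1.real_of_complex
    convert h2 using 2
    field_simp
  have hmono : StrictMonoOn q (Icc 0 1) := by
    refine strictMonoOn_of_deriv_pos (convex_Icc 0 1)
      (fun x hx => (hq x hx).continuousAt.continuousWithinAt) fun x hx => ?_
    have hx' := interior_subset hx
    rw [(hq x hx').deriv]
    exact hpos _ (hmem x hx')
  have := hmono (left_mem_Icc.mpr zero_le_one) (right_mem_Icc.mpr zero_le_one) zero_lt_one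
  simp [q, huv] at this

theorem analyticAt_dslope {f : ℂ → ℂ} {z₀ : ℂ} (hf : AnalyticAt ℂ f z₀) :
    AnalyticAt ℂ (dslope f z₀) z₀ :=
  let ⟨_, hp⟩ := hf
  ⟨_, hp.has_fpower_series_dslope_fslope⟩

/-- Near a double zero `z₀` a holomorphic function `T` is the square of a local coordinate. Hence
`T (g s) = s ^ 2` for a holomorphic local parameterization `g`, whose speed at `0` may be
prescribed to be either square root of `2 / T''(z₀)`. -/
theorem exists_sq_parametrization {T : ℂ → ℂ} {z₀ c : ℂ} (hT : AnalyticAt ℂ T z₀)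
    (h0 : T z₀ = 0) (h1 : deriv T z₀ = 0) (hc : c ≠ 0)
    (h2 : HasDerivAt (deriv T) (2 * c ^ 2) z₀) :
    ∃ g : ℂ → ℂ, AnalyticAt ℂ g 0 ∧ g 0 = z₀ ∧ HasDerivAt g c⁻¹ 0 ∧
      ∀ᶠ s in 𝓝 0, T (g s) = s ^ 2 := by
  set d := dslope T z₀ with hd
  set k := dslope d z₀ with hk
  have hda : AnalyticAt ℂ d z₀ := analyticAt_dslope hT
  have hka : AnalyticAt ℂ k z₀ := analyticAt_dslope hda
  have hTd : ∀ z, T z = (z - z₀) * d z := fun z => by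
    have := sub_smul_dslope T z₀ z
    simp only [h0, sub_zero, smul_eq_mul] at this
    exact this.symm
  have hd0 : d z₀ = 0 := by rw [hd, dslope_same, h1]
  have hdk : ∀ z, d z = (z - z₀) * k z := fun z => by
    have := sub_smul_dslope d z₀ z
    simp only [hd0, sub_zero, smul_eq_mul] at this
    exact this.symm
  have hk0 : k z₀ = c ^ 2 := by
    have hT' : deriv T =ᶠ[𝓝 z₀] fun z => d z + (z - z₀) * deriv d z := by
      filter_upwards [hda.eventually_analyticAt] with z hz
      have e : HasDerivAt (fun z => (z - z₀) * d z) (1 * d z + (z - z₀) * deriv d z) z :=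
        ((hasDerivAt_id z).sub_const z₀).mul hz.differentiableAt.hasDerivAt
      rw [funext hTd, e.deriv, one_mul]
    have e2 : HasDerivAt (fun z => d z + (z - z₀) * deriv d z)
        (deriv d z₀ + (1 * deriv d z₀ + (z₀ - z₀) * deriv (deriv d) z₀)) z₀ :=
      hda.differentiableAt.hasDerivAt.add
        (((hasDerivAt_id z₀).sub_const z₀).mul hda.deriv.differentiableAt.hasDerivAt)
    have e3 := (h2.congr_of_eventuallyEq hT'.symm).unique e2
    rw [hk, dslope_same]
    linear_combination -e3 / 2
  -- `S` is the square root of `T` with `S' (z₀) = c`.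
  let σ : ℂ → ℂ := fun z => c * Complex.exp (Complex.log (k z / c ^ 2) / 2)
  have hc2 : c ^ 2 ≠ 0 := pow_ne_zero 2 hc
  have hσ0 : σ z₀ = c := by simp [σ, hk0, hc]
  have hσa : AnalyticAt ℂ σ z₀ := by
    refine analyticAt_const.mul (AnalyticAt.cexp (AnalyticAt.div_const (AnalyticAt.clog
      hka.div_const ?_)))
    rw [hk0, div_self hc2]; exact Complex.one_mem_slitPlane
  have hσ2 : ∀ᶠ z in 𝓝 z₀, σ z ^ 2 = k z := by
    have hne : ∀ᶠ z in 𝓝 z₀, k z ≠ 0 :=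
      hka.continuousAt.eventually_ne (by rw [hk0]; exact hc2)
    filter_upwards [hne] with z hz
    simp only [σ, mul_pow, ← Complex.exp_nat_mul]
    rw [show ((2 : ℕ) : ℂ) * (Complex.log (k z / c ^ 2) / 2) = Complex.log (k z / c ^ 2) by
      push_cast; ring, Complex.exp_log (div_ne_zero hz hc2)]
    field_simp
  let S : ℂ → ℂ := fun z => (z - z₀) * σ z
  have hSa : AnalyticAt ℂ S z₀ := (analyticAt_id.sub analyticAt_const).mul hσa
  have hS' : deriv S z₀ = c := by
    have e : HasDerivAt S (1 * σ z₀ + (z₀ - z₀) * deriv σ z₀) z₀ :=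
      ((hasDerivAt_id z₀).sub_const z₀).mul hσa.differentiableAt.hasDerivAt
    rw [e.deriv, hσ0]; ring
  have hS0 : S z₀ = 0 := by simp [S]
  have hne : deriv S z₀ ≠ 0 := by rwa [hS']
  have hSs := hSa.hasStrictDerivAt
  refine ⟨hSs.localInverse S _ z₀ hne, ?_, ?_, ?_, ?_⟩
  · have := hSa.analyticAt_localInverse hne
    rwa [hS0] at this
  · have := (hSs.eventually_left_inverse (hf' := hne)).self_of_nhds
    rwa [hS0] at this
  · have := (hSs.to_localInverse hne).hasDerivAt
    rw [hS0] at this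
    exact this.congr_deriv (congrArg _ hS')
  · have hr := hSs.eventually_right_inverse (hf' := hne)
    have ht : Tendsto (hSs.localInverse S _ z₀ hne) (𝓝 0) (𝓝 z₀) := by
      have h := (hSs.to_localInverse hne).hasDerivAt.continuousAt.tendsto
      rwa [(hSs.eventually_left_inverse (hf' := hne)).self_of_nhds, hS0] at h
    rw [hS0] at hr
    filter_upwards [hr, ht.eventually hσ2] with s hs hs2
    rw [hTd, hdk, ← hs2]
    linear_combination (S (hSs.localInverse S _ z₀ hne s) + s) * hs

/-- The `z`-derivatives of a continuous family of holomorphic functions are jointly continuous. -/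
theorem tendsto_deriv_of_continuousOn {U : Set ℂ} (hU : IsOpen U) {I : Set ℝ} {f : ℂ → ℝ → ℂ}
    (hc : ContinuousOn (fun p : ℂ × ℝ => f p.1 p.2) (U ×ˢ I))
    (hh : ∀ t ∈ I, DifferentiableOn ℂ (fun z => f z t) U) {z : ℂ} (hz : z ∈ U) {t : ℝ}
    (ht : t ∈ I) :
    Tendsto (fun p : ℝ × ℂ => deriv (fun w => f w p.1) p.2) (𝓝[I] t ×ˢ 𝓝 z)
      (𝓝 (deriv (fun w => f w t) z)) := by
  have hlu : TendstoLocallyUniformlyOn (fun s w => f w s) (fun w => f w t) (𝓝[I] t) U := by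
    rw [Metric.tendstoLocallyUniformlyOn_iff]
    intro ε hε x hx
    have h1 := hc (x, t) ⟨hx, ht⟩
    rw [ContinuousWithinAt, nhdsWithin_prod_eq] at h1
    have h2 := h1.eventually (Metric.ball_mem_nhds _ (half_pos hε))
    obtain ⟨pa, hpa, pb, hpb, h3⟩ := eventually_prod_iff.mp h2
    refine ⟨{y | pa y}, hpa, ?_⟩
    filter_upwards [hpb] with s hs y hy
    have e1 : dist (f y s) (f x t) < ε / 2 := h3 hy hs
    have e2 : dist (f y t) (f x t) < ε / 2 := h3 hy (hpb.self_of_nhdsWithin ht)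
    have := dist_triangle_right (f y t) (f y s) (f x t)
    linarith
  have hlu' := hlu.deriv (eventually_nhdsWithin_of_forall hh) hU
  rw [Metric.tendstoLocallyUniformlyOn_iff] at hlu'
  have hcont : ContinuousAt (deriv fun w => f w t) z :=
    (((hh t ht).analyticAt (hU.mem_nhds hz)).deriv).continuousAt
  rw [Metric.tendsto_nhds]
  intro ε hε
  obtain ⟨N, hN, hN'⟩ := hlu' (ε / 2) (half_pos hε) z hz
  rw [hU.nhdsWithin_eq hz] at hN
  have h4 := hcont.eventually (Metric.ball_mem_nhds _ (half_pos hε))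
  filter_upwards [hN'.prod_mk (h4.and hN)] with p hp
  have e1 := hp.1 p.2 hp.2.2
  have e2 : dist (deriv (fun w => f w t) p.2) (deriv (fun w => f w t) z) < ε / 2 := hp.2.1
  have := dist_triangle_left (deriv (fun w => f w p.1) p.2) (deriv (fun w => f w t) z)
    (deriv (fun w => f w t) p.2)
  simp only [Function.comp_apply] at e1
  linarith

/-- The chain rule along a moving point for a continuous family of holomorphic functions with
partial derivatives in time. -/
theorem hasDerivWithinAt_along {U : Set ℂ} (hU : IsOpen U) {I : Set ℝ} {f : ℂ → ℝ → ℂ}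
    (hc : ContinuousOn (fun p : ℂ × ℝ => f p.1 p.2) (U ×ˢ I))
    (hh : ∀ t ∈ I, DifferentiableOn ℂ (fun z => f z t) U) {Z : ℝ → ℂ} {t : ℝ} (ht : t ∈ I)
    (hz : Z t ∈ U) {Z' D : ℂ} (hZ : HasDerivWithinAt Z Z' I t)
    (hD : HasDerivWithinAt (fun s => f (Z t) s) D I t) :
    HasDerivWithinAt (fun s => f (Z s) s) (deriv (fun w => f w t) (Z t) * Z' + D) I t := by
  set A := deriv (fun w => f w t) (Z t) with hA
  have hlo : (fun s => f (Z s) s - f (Z t) s - A * (Z s - Z t)) =o[𝓝[I] t]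
      fun s => Z s - Z t := by
    rw [Asymptotics.isLittleO_iff]
    intro ε hε
    have h1 := (tendsto_deriv_of_continuousOn hU hc hh hz ht).eventually (Metric.ball_mem_nhds _ hε)
    obtain ⟨pa, hpa, pb, hpb, h2⟩ := eventually_prod_iff.mp h1
    obtain ⟨δ, hδ, hball⟩ := Metric.mem_nhds_iff.mp (inter_mem (hU.mem_nhds hz) hpb)
    filter_upwards [hpa, hZ.continuousWithinAt.eventually (Metric.ball_mem_nhds _ hδ),
      self_mem_nhdsWithin] with s hs hZs hsI
    have h3 := (convex_ball (Z t) δ).norm_image_sub_le_of_norm_hasDerivWithin_le (C := ε)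
      (f := fun w => f w s - A * w) (f' := fun w => deriv (fun w => f w s) w - A * 1)
      (fun w hw => (((((hh s hsI).differentiableAt (hU.mem_nhds (hball hw).1)).hasDerivAt).sub
        ((hasDerivAt_id w).const_mul A)).hasDerivWithinAt))
      (fun w hw => by
        have h4 : dist (deriv (fun w => f w s) w) A < ε := h2 hs (hball hw).2
        rw [mul_one, ← dist_eq_norm]
        exact h4.le) (Metric.mem_ball_self hδ) hZs
    rw [show f (Z s) s - f (Z t) s - A * (Z s - Z t)
      = f (Z s) s - A * Z s - (f (Z t) s - A * Z t) by ring]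
    exact h3
  have hlo' := hlo.trans_isBigO hZ.hasFDerivWithinAt.isBigO_sub
  have hAZ : HasDerivWithinAt (fun s => A * (Z s - Z t)) (A * Z') I t :=
    (hZ.sub_const (Z t)).const_mul A
  rw [hasDerivWithinAt_iff_isLittleO] at hAZ hD ⊢
  refine ((hlo'.add hAZ).add hD).congr_left fun s => ?_
  simp only [smul_add]
  ring

/-! ### The derivative and the univalence of `φ_a` -/

theorem one_add_I_mul_ne_zero (a : ℝ) : (1 + Complex.I * a : ℂ) ≠ 0 := by
  intro h
  have := congrArg Complex.re h
  simp at this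

theorem one_sub_I_mul_ne_zero (a : ℝ) : (1 - Complex.I * a : ℂ) ≠ 0 := by
  intro h
  have := congrArg Complex.re h
  simp at this

theorem b_mul (a : ℝ) : b a * (1 + Complex.I * a) = 1 - Complex.I * a := by
  rw [b, div_mul_cancel₀ _ (one_add_I_mul_ne_zero a)]

/-- The plane slit along a ray from `-b` to infinity, where `logBranch a` is holomorphic; it
contains the disc and the boundary point `1`. -/
def branchDomain (a : ℝ) : Set ℂ := {z | 1 + z / b a ∈ Complex.slitPlane}

theorem isOpen_branchDomain (a : ℝ) : IsOpen (branchDomain a) :=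
  Complex.isOpen_slitPlane.preimage (by fun_prop)

theorem disc_subset_branchDomain (a : ℝ) : disc ⊆ branchDomain a := fun _ hz =>
  one_add_div_b_mem a hz

theorem one_mem_branchDomain (a : ℝ) : (1 : ℂ) ∈ branchDomain a := by
  refine Or.inl ?_
  have h : 1 + 1 / b a = 2 / (1 - Complex.I * a) := by
    have h1 := one_add_I_mul_ne_zero a
    have h2 := one_sub_I_mul_ne_zero a
    rw [b]; field_simp; ring
  rw [h, Complex.div_re]
  simp [Complex.normSq_apply]
  nlinarith [mul_self_nonneg a]

theorem add_b_ne_zero {a : ℝ} {z : ℂ} (hz : z ∈ branchDomain a) : z + b a ≠ 0 := by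
  have h1 := Complex.slitPlane_ne_zero hz
  have h2 : z + b a = b a * (1 + z / b a) := by
    rw [mul_add, mul_div_cancel₀ _ (b_ne_zero a)]; ring
  rw [h2]
  exact mul_ne_zero (b_ne_zero a) h1

theorem hasDerivAt_logBranch {a : ℝ} {z : ℂ} (hz : z ∈ branchDomain a) :
    HasDerivAt (logBranch a) (z + b a)⁻¹ z := by
  have h := ((((hasDerivAt_id z).div_const (b a)).const_add 1).clog hz).const_add
    (Complex.log (b a))
  refine h.congr_deriv ?_
  have h1 := add_b_ne_zero hz
  have h2 := b_ne_zero a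
  have h3 : 1 + z / b a ≠ 0 := Complex.slitPlane_ne_zero hz
  have h4 : b a + z ≠ 0 := by rwa [add_comm]
  simp only [id]
  field_simp
  ring

/-- The exponent `(-1-b) log (z+b)`, so that `φ_a(z) = z exp (exponent a z)`. -/
noncomputable def exponent (a : ℝ) (z : ℂ) : ℂ := (-1 - b a) * logBranch a z

theorem phi_eq (a : ℝ) (z : ℂ) : phi a z = z * Complex.exp (exponent a z) := rfl

theorem hasDerivAt_exponent {a : ℝ} {z : ℂ} (hz : z ∈ branchDomain a) :
    HasDerivAt (exponent a) ((-1 - b a) * (z + b a)⁻¹) z :=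
  (hasDerivAt_logBranch hz).const_mul _

theorem hasDerivAt_phi {a : ℝ} {z : ℂ} (hz : z ∈ branchDomain a) :
    HasDerivAt (phi a) (Complex.exp (exponent a z) * (b a * (1 - z) / (z + b a))) z := by
  have h := (hasDerivAt_id z).mul (hasDerivAt_exponent hz).cexp
  refine h.congr_deriv ?_
  have h1 := add_b_ne_zero hz
  simp only [id]
  field_simp
  ring

theorem phi_zero (a : ℝ) : phi a 0 = 0 := by simp [phi]

theorem phi_eq_zero_iff {a : ℝ} {z : ℂ} : phi a z = 0 ↔ z = 0 := by
  simp [phi_eq, Complex.exp_ne_zero]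

theorem differentiableOn_phi (a : ℝ) : DifferentiableOn ℂ (phi a) disc := fun _ hz =>
  (hasDerivAt_phi (disc_subset_branchDomain a hz)).differentiableAt.differentiableWithinAt

theorem ne_one_of_mem_disc {z : ℂ} (hz : z ∈ disc) : z ≠ 1 := by
  rintro rfl
  simp [mem_disc] at hz

theorem deriv_phi_ne_zero {a : ℝ} {z : ℂ} (hz : z ∈ disc) : deriv (phi a) z ≠ 0 := by
  rw [(hasDerivAt_phi (disc_subset_branchDomain a hz)).deriv]
  exact mul_ne_zero (Complex.exp_ne_zero _) (div_ne_zero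
    (mul_ne_zero (b_ne_zero a) (sub_ne_zero.mpr (ne_one_of_mem_disc hz).symm))
    (add_b_ne_zero (disc_subset_branchDomain a hz)))

/-- The function `p` of positive real part with `z φ_a'(z) / φ_a(z) = (1 - ia) / p(z)`. -/
noncomputable def herglotz (a : ℝ) (z : ℂ) : ℂ := (1 + z) / (1 - z) - Complex.I * a

theorem cayley_re (z : ℂ) : ((1 + z) / (1 - z)).re = (1 - ‖z‖ ^ 2) / ‖1 - z‖ ^ 2 := by
  rw [Complex.div_re, ← Complex.normSq_eq_norm_sq, ← Complex.normSq_eq_norm_sq,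
    ← add_div]
  congr 1
  simp [Complex.normSq_apply]
  ring

theorem herglotz_re_pos (a : ℝ) {z : ℂ} (hz : z ∈ disc) : 0 < (herglotz a z).re := by
  have h1 : (herglotz a z).re = ((1 + z) / (1 - z)).re := by simp [herglotz]
  rw [h1, cayley_re]
  have h2 : 0 < ‖1 - z‖ := norm_pos_iff.mpr (sub_ne_zero.mpr (ne_one_of_mem_disc hz).symm)
  have h3 := mem_disc.mp hz
  have : ‖z‖ ^ 2 < 1 := by nlinarith [norm_nonneg z]
  exact div_pos (by linarith) (by positivity)

theorem herglotz_ne_zero (a : ℝ) {z : ℂ} (hz : z ∈ disc) : herglotz a z ≠ 0 := fun h => by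
  have := herglotz_re_pos a hz
  simp [h] at this

theorem logDeriv_mul_herglotz {a : ℝ} {z : ℂ} (hz : z ∈ branchDomain a) (h1 : z ≠ 1) :
    b a * (1 - z) / (z + b a) * herglotz a z = 1 - Complex.I * a := by
  have h2 := add_b_ne_zero hz
  have h3 : 1 - z ≠ 0 := sub_ne_zero.mpr h1.symm
  rw [herglotz]
  field_simp
  linear_combination z * b_mul a

theorem injOn_phi (a : ℝ) : InjOn (phi a) disc := by
  -- In the logarithmic coordinate `z = exp u`, `φ_a = exp ∘ Φ` with `Φ` injective.
  let Φ : ℂ → ℂ := fun u => u + exponent a (Complex.exp u)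
  have hmem : ∀ u ∈ {u : ℂ | u.re < 0}, Complex.exp u ∈ disc := fun u hu => by
    rw [mem_disc, Complex.norm_exp]; simpa using hu
  have hΦ : ∀ u ∈ {u : ℂ | u.re < 0}, HasDerivAt Φ
      (b a * (1 - Complex.exp u) / (Complex.exp u + b a)) u := fun u hu => by
    have hd := disc_subset_branchDomain a (hmem u hu)
    have h := (hasDerivAt_id u).add
      (HasDerivAt.comp u (hasDerivAt_exponent hd) (Complex.hasDerivAt_exp u))
    refine h.congr_deriv ?_
    have h1 := add_b_ne_zero hd
    field_simp
    ring
  have hinj : InjOn Φ {u : ℂ | u.re < 0} := by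
    refine injOn_of_re_deriv_pos (convex_halfSpace_re_lt 0) (1 - Complex.I * a)⁻¹ hΦ fun u hu => ?_
    have hw := hmem u hu
    have h1 := logDeriv_mul_herglotz (disc_subset_branchDomain a hw) (ne_one_of_mem_disc hw)
    have h2 := herglotz_ne_zero a hw
    rw [← h1, mul_inv, mul_right_comm, inv_mul_cancel₀, one_mul, Complex.inv_re]
    · exact div_pos (herglotz_re_pos a hw) (Complex.normSq_pos.mpr h2)
    · intro h
      rw [h, zero_mul] at h1
      exact one_sub_I_mul_ne_zero a h1.symm
  have hexp : ∀ u, Complex.exp (Φ u) = phi a (Complex.exp u) := fun u => by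
    rw [phi_eq, Complex.exp_add]
  intro z hz w hw hzw
  by_cases hz0 : z = 0
  · rw [hz0, phi_zero] at hzw
    rw [hz0, phi_eq_zero_iff.mp hzw.symm]
  have hw0 : w ≠ 0 := fun h => hz0 (by rwa [h, phi_zero, phi_eq_zero_iff] at hzw)
  have hlog : ∀ x ∈ disc, x ≠ 0 → (Complex.log x).re < 0 := fun x hx hx0 => by
    rw [Complex.log_re]
    exact Real.log_neg (norm_pos_iff.mpr hx0) (mem_disc.mp hx)
  have h1 : Complex.exp (Φ (Complex.log z)) = Complex.exp (Φ (Complex.log w)) := by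
    rw [hexp, hexp, Complex.exp_log hz0, Complex.exp_log hw0, hzw]
  obtain ⟨n, hn⟩ := Complex.exp_eq_exp_iff_exists_int.mp h1
  have hper : Complex.exp (Complex.log w + n * (2 * Real.pi * Complex.I)) = w := by
    rw [Complex.exp_add, Complex.exp_int_mul_two_pi_mul_I, mul_one, Complex.exp_log hw0]
  have h2 : Φ (Complex.log z) = Φ (Complex.log w + n * (2 * Real.pi * Complex.I)) := by
    rw [hn]
    simp only [Φ, hper, Complex.exp_log hw0]
    ring
  have h3 := hinj (hlog z hz hz0) (by simpa using hlog w hw hw0) h2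
  rw [← Complex.exp_log hz0, h3, hper]

/-! ### The inverse of `φ_a` and the spirals in its image -/

/-- The inverse of `φ_a` on the image of the disc. -/
noncomputable def phiInv (a : ℝ) : ℂ → ℂ := Function.invFunOn (phi a) disc

theorem isOpen_image_phi (a : ℝ) : IsOpen (phi a '' disc) :=
  isOpen_image_of_deriv_ne_zero isOpen_disc (differentiableOn_phi a) fun _ => deriv_phi_ne_zero

theorem phiInv_phi {a : ℝ} {z : ℂ} (hz : z ∈ disc) : phiInv a (phi a z) = z :=
  (injOn_phi a).leftInvOn_invFunOn hz

theorem phiInv_mem {a : ℝ} {v : ℂ} (hv : v ∈ phi a '' disc) : phiInv a v ∈ disc :=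
  Function.invFunOn_mem hv

theorem phi_phiInv {a : ℝ} {v : ℂ} (hv : v ∈ phi a '' disc) : phi a (phiInv a v) = v :=
  Function.invFunOn_eq hv

theorem phiInv_zero (a : ℝ) : phiInv a 0 = 0 := by
  have h := phiInv_phi (a := a) (z := 0) (by simp [mem_disc])
  rwa [phi_zero] at h

theorem hasDerivAt_phiInv {a : ℝ} {v : ℂ} (hv : v ∈ phi a '' disc) :
    HasDerivAt (phiInv a) (deriv (phi a) (phiInv a v))⁻¹ v :=
  hasDerivAt_invFunOn isOpen_disc (differentiableOn_phi a) (injOn_phi a)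
    (fun _ => deriv_phi_ne_zero) hv

theorem differentiableOn_phiInv (a : ℝ) : DifferentiableOn ℂ (phiInv a) (phi a '' disc) :=
  fun _ hv => (hasDerivAt_phiInv hv).differentiableAt.differentiableWithinAt

/-- The pullback under `φ_a` of the linear vector field `v ↦ (ia - 1) v`. -/
noncomputable def spiralField (a : ℝ) (z : ℂ) : ℂ := -(z * herglotz a z)

theorem deriv_phi_mul_spiralField {a : ℝ} {z : ℂ} (hz : z ∈ disc) :
    deriv (phi a) z * spiralField a z = (Complex.I * a - 1) * phi a z := by
  have hz' := disc_subset_branchDomain a hz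
  have h := logDeriv_mul_herglotz hz' (ne_one_of_mem_disc hz)
  rw [(hasDerivAt_phi hz').deriv, spiralField, phi_eq]
  linear_combination (-z * Complex.exp (exponent a z)) * h

/-- The spiral `t ↦ v e^{(ia-1)t}` read in the disc through `φ_a`. -/
noncomputable def orbit (a : ℝ) (v : ℂ) (t : ℝ) : ℂ :=
  phiInv a (Complex.exp ((Complex.I * a - 1) * t) * v)

theorem hasDerivAt_spiral (a : ℝ) (v : ℂ) (t : ℝ) :
    HasDerivAt (fun s : ℝ => Complex.exp ((Complex.I * a - 1) * s) * v)
      ((Complex.I * a - 1) * (Complex.exp ((Complex.I * a - 1) * t) * v)) t := by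
  have h := ((((hasDerivAt_id (t : ℂ)).const_mul (Complex.I * a - 1)).cexp).mul_const v).comp_ofReal
  simp only [id, mul_one] at h
  refine h.congr_deriv ?_
  ring

theorem hasDerivAt_orbit {a : ℝ} {v : ℂ} {t : ℝ}
    (h : Complex.exp ((Complex.I * a - 1) * t) * v ∈ phi a '' disc) :
    HasDerivAt (orbit a v) (spiralField a (orbit a v t)) t := by
  have h1 := (hasDerivAt_phiInv h).comp_of_eq t (hasDerivAt_spiral a v t) rfl
  refine h1.congr_deriv ?_
  have h2 := deriv_phi_mul_spiralField (a := a) (phiInv_mem h)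
  rw [phi_phiInv h] at h2
  rw [inv_mul_eq_iff_eq_mul₀ (deriv_phi_ne_zero (phiInv_mem h)), ← h2, orbit]

/-- Along the field, the modulus decreases at the logarithmic rate `Re p > 0`. -/
theorem hasDerivAt_norm_sq {a : ℝ} {y : ℝ → ℂ} {t : ℝ}
    (h : HasDerivAt y (spiralField a (y t)) t) :
    HasDerivAt (fun s => ‖y s‖ ^ 2) (-(2 * ‖y t‖ ^ 2 * (herglotz a (y t)).re)) t := by
  refine h.norm_sq.congr_deriv ?_
  rw [spiralField, ← Complex.normSq_eq_norm_sq, Complex.inner, Complex.normSq_apply]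
  simp
  ring

theorem spiral_mem_closedBall {a : ℝ} {w : ℂ} (hw : w ∈ disc) {t : ℝ} (ht : 0 ≤ t) :
    Complex.exp ((Complex.I * a - 1) * t) * phi a w ∈ phi a '' Metric.closedBall 0 ‖w‖ := by
  set c : ℝ → ℂ := fun s => Complex.exp ((Complex.I * a - 1) * s) * phi a w with hc
  have hcc : Continuous c := by fun_prop
  have hsub : Metric.closedBall 0 ‖w‖ ⊆ disc := fun z hz => by
    rw [mem_disc]
    exact (by simpa using hz : ‖z‖ ≤ ‖w‖).trans_lt (mem_disc.mp hw)
  have hclosed : IsClosed (c ⁻¹' (phi a '' Metric.closedBall 0 ‖w‖)) :=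
    (((isCompact_closedBall (0 : ℂ) ‖w‖).image_of_continuousOn
      ((differentiableOn_phi a).continuousOn.mono hsub)).isClosed).preimage hcc
  suffices hI : Icc 0 t ⊆ c ⁻¹' (phi a '' Metric.closedBall 0 ‖w‖) from hI ⟨ht, le_rfl⟩
  refine (hclosed.inter isClosed_Icc).Icc_subset_of_forall_exists_gt ?_ ?_
  · exact ⟨w, by simp, by simp [hc]⟩
  · rintro x ⟨⟨z, hz, hzx⟩, -⟩ y hy
    -- The image is open, and as long as the spiral is in it the modulus of its preimage decreases.
    have hmem : c x ∈ phi a '' disc := ⟨z, hsub hz, hzx⟩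
    obtain ⟨ε, hε, hball⟩ := Metric.mem_nhds_iff.mp
      (hcc.continuousAt.preimage_mem_nhds ((isOpen_image_phi a).mem_nhds hmem))
    set s := min y (x + ε / 2) with hs
    have hxs : x < s := lt_min hy (by linarith)
    have hin : ∀ r ∈ Icc x s, c r ∈ phi a '' disc := fun r hr => hball (by
      rw [Metric.mem_ball, Real.dist_eq, abs_of_nonneg (by linarith [hr.1])]
      have := hr.2.trans (min_le_right _ _)
      linarith)
    have hder : ∀ r ∈ Icc x s, HasDerivAt (fun r => ‖orbit a (phi a w) r‖ ^ 2)
        (-(2 * ‖orbit a (phi a w) r‖ ^ 2 * (herglotz a (orbit a (phi a w) r)).re)) r :=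
      fun r hr => hasDerivAt_norm_sq (hasDerivAt_orbit (hin r hr))
    have hanti : AntitoneOn (fun r => ‖orbit a (phi a w) r‖ ^ 2) (Icc x s) := by
      refine antitoneOn_of_hasDerivWithinAt_nonpos (convex_Icc x s)
        (fun r hr => (hder r hr).continuousAt.continuousWithinAt)
        (fun r hr => (hder r (interior_subset hr)).hasDerivWithinAt) fun r hr => ?_
      have := herglotz_re_pos a (phiInv_mem (hin r (interior_subset hr)))
      have h2 : 0 ≤ 2 * ‖orbit a (phi a w) r‖ ^ 2 * (herglotz a (orbit a (phi a w) r)).re :=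
        mul_nonneg (by positivity) this.le
      linarith
    have hle := hanti (left_mem_Icc.mpr hxs.le) (right_mem_Icc.mpr hxs.le) hxs.le
    have hox : orbit a (phi a w) x = z := by
      change phiInv a (c x) = z
      rw [← hzx, phiInv_phi (hsub hz)]
    have hle' : ‖orbit a (phi a w) s‖ ≤ ‖z‖ := by
      rw [← hox]
      exact (sq_le_sq₀ (norm_nonneg _) (norm_nonneg _)).mp hle
    refine ⟨s, ⟨orbit a (phi a w) s, ?_, phi_phiInv (hin s (right_mem_Icc.mpr hxs.le))⟩,
      hxs, min_le_left _ _⟩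
    simpa using hle'.trans (by simpa using hz)

theorem spiral_mem {a : ℝ} {v : ℂ} (hv : v ∈ phi a '' disc) {t : ℝ} (ht : 0 ≤ t) :
    Complex.exp ((Complex.I * a - 1) * t) * v ∈ phi a '' disc := by
  obtain ⟨w, hw, rfl⟩ := hv
  obtain ⟨z, hz, h⟩ := spiral_mem_closedBall (a := a) hw ht
  exact ⟨z, mem_disc.mpr ((by simpa using hz : ‖z‖ ≤ ‖w‖).trans_lt (mem_disc.mp hw)), h⟩

theorem isSimplyConnected_image_phi (a : ℝ) : IsSimplyConnected (phi a '' disc) := by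
  have hd : SimplyConnectedSpace disc := by
    have : ContractibleSpace disc :=
      (convex_ball (0 : ℂ) 1).contractibleSpace ⟨0, by simp⟩
    infer_instance
  let e : disc ≃ₜ phi a '' disc :=
    { toFun := fun z => ⟨phi a z, mem_image_of_mem _ z.2⟩
      invFun := fun v => ⟨phiInv a v, phiInv_mem v.2⟩
      left_inv := fun z => Subtype.ext (phiInv_phi z.2)
      right_inv := fun v => Subtype.ext (phi_phiInv v.2)
      continuous_toFun := by
        exact (continuousOn_iff_continuous_domRestrict.mp
          (differentiableOn_phi a).continuousOn).subtype_mk _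
      continuous_invFun := by
        exact (continuousOn_iff_continuous_domRestrict.mp
          (differentiableOn_phiInv a).continuousOn).subtype_mk _ }
  exact e.toHomotopyEquiv.simplyConnectedSpace_iff.mp hd

theorem exp_arccot_sub (a : ℝ) :
    Complex.exp (Complex.I * ((arccot a - Real.pi / 2 : ℝ) : ℂ))
      = (1 - Complex.I * a) / (Real.sqrt (1 + a ^ 2) : ℂ) := by
  have h : arccot a - Real.pi / 2 = -Real.arctan a := by rw [arccot]; ring
  rw [h, mul_comm, Complex.exp_mul_I, ← Complex.ofReal_cos, ← Complex.ofReal_sin, Real.cos_neg,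
    Real.sin_neg, Real.cos_arctan, Real.sin_arctan]
  push_cast
  ring

theorem isSpirallike_phi (a : ℝ) : IsSpirallike (arccot a - Real.pi / 2) (phi a) where
  holomorphic := differentiableOn_phi a
  univalent := injOn_phi a
  map_zero := phi_zero a
  image :=
    { isOpen := isOpen_image_phi a
      simplyConnected := isSimplyConnected_image_phi a
      zero_mem := ⟨0, by simp [mem_disc], phi_zero a⟩
      spiral_mem := fun w hw t ht => by
        -- The unit-speed spiral is traversed after the time change by `√(1 + a²)`.
        have h := spiral_mem hw (div_nonneg ht (Real.sqrt_nonneg (1 + a ^ 2)))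
        rw [exp_arccot_sub, mul_comm]
        convert h using 3
        push_cast
        ring }

/-! ### The explicit Loewner flow -/

theorem driving_ne_zero (a t : ℝ) : driving a t ≠ 0 := Complex.exp_ne_zero _

theorem norm_driving (a t : ℝ) : ‖driving a t‖ = 1 := by
  rw [driving, mul_assoc, mul_comm, ← Complex.ofReal_mul, Complex.norm_exp_ofReal_mul_I]

theorem exp_neg_eq_inv_driving (a t : ℝ) :
    Complex.exp (-(Complex.I * a * t)) = (driving a t)⁻¹ := by
  rw [driving, Complex.exp_neg]

theorem inv_driving_mul_mem {z : ℂ} (hz : z ∈ disc) (a t : ℝ) : (driving a t)⁻¹ * z ∈ disc := by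
  rw [mem_disc, norm_mul, norm_inv, norm_driving, inv_one, one_mul]
  exact mem_disc.mp hz

theorem driving_mul_mem {z : ℂ} (hz : z ∈ disc) (a t : ℝ) : driving a t * z ∈ disc := by
  rw [mem_disc, norm_mul, norm_driving, one_mul]
  exact mem_disc.mp hz

theorem hasDerivAt_driving (a t : ℝ) :
    HasDerivAt (driving a) (Complex.I * a * driving a t) t := by
  have h := (((hasDerivAt_id (t : ℂ)).const_mul (Complex.I * a)).cexp).comp_ofReal
  simp only [id, mul_one] at h
  exact h.congr_deriv (mul_comm _ _)

theorem continuous_driving (a : ℝ) : Continuous (driving a) :=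
  continuous_iff_continuousAt.mpr fun t => (hasDerivAt_driving a t).continuousAt

theorem hasDerivAt_inv_driving (a t : ℝ) :
    HasDerivAt (fun s => (driving a s)⁻¹) (-(Complex.I * a * (driving a t)⁻¹)) t := by
  refine ((hasDerivAt_driving a t).inv (driving_ne_zero a t)).congr_deriv ?_
  have := driving_ne_zero a t
  field_simp

/-- The solution `φ_a⁻¹(e^{(ia-1)t} φ_a(e^{-iat} z))` of the Loewner equation. -/
noncomputable def flow (a : ℝ) (z : ℂ) (t : ℝ) : ℂ := orbit a (phi a ((driving a t)⁻¹ * z)) t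

theorem flow_arg_mem (a : ℝ) {z : ℂ} (hz : z ∈ disc) {t : ℝ} (ht : 0 ≤ t) :
    Complex.exp ((Complex.I * a - 1) * t) * phi a ((driving a t)⁻¹ * z) ∈ phi a '' disc :=
  spiral_mem (mem_image_of_mem _ (inv_driving_mul_mem hz a t)) ht

theorem flow_mem (a : ℝ) {z : ℂ} (hz : z ∈ disc) {t : ℝ} (ht : 0 ≤ t) : flow a z t ∈ disc :=
  phiInv_mem (flow_arg_mem a hz ht)

theorem phi_flow (a : ℝ) {z : ℂ} (hz : z ∈ disc) {t : ℝ} (ht : 0 ≤ t) :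
    phi a (flow a z t)
      = Complex.exp ((Complex.I * a - 1) * t) * phi a ((driving a t)⁻¹ * z) :=
  phi_phiInv (flow_arg_mem a hz ht)

theorem hasDerivAt_flow_left (a : ℝ) {z : ℂ} (hz : z ∈ disc) {t : ℝ} (ht : 0 ≤ t) :
    HasDerivAt (fun z => flow a z t)
      ((deriv (phi a) (flow a z t))⁻¹ * (Complex.exp ((Complex.I * a - 1) * t) *
        (deriv (phi a) ((driving a t)⁻¹ * z) * (driving a t)⁻¹))) z := by
  have h1 : HasDerivAt (phi a) (deriv (phi a) ((driving a t)⁻¹ * z)) ((driving a t)⁻¹ * z) :=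
    ((differentiableOn_phi a).differentiableAt
      (isOpen_disc.mem_nhds (inv_driving_mul_mem hz a t))).hasDerivAt
  have h2 : HasDerivAt (fun z => (driving a t)⁻¹ * z) ((driving a t)⁻¹ * 1) z :=
    (hasDerivAt_id z).const_mul _
  rw [mul_one] at h2
  exact (hasDerivAt_phiInv (flow_arg_mem a hz ht)).comp z
    ((h1.comp z h2).const_mul (Complex.exp ((Complex.I * a - 1) * t)))

theorem hasDerivAt_flow_right (a : ℝ) {z : ℂ} (hz : z ∈ disc) {t : ℝ} (ht : 0 ≤ t) :
    HasDerivAt (fun t => flow a z t)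
      (-(z * deriv (fun w => flow a w t) z * ((driving a t + z) / (driving a t - z)))) t := by
  have hw := inv_driving_mul_mem hz a t
  have h1 : HasDerivAt (phi a) (deriv (phi a) ((driving a t)⁻¹ * z)) ((driving a t)⁻¹ * z) :=
    ((differentiableOn_phi a).differentiableAt (isOpen_disc.mem_nhds hw)).hasDerivAt
  have h2 := (hasDerivAt_inv_driving a t).mul_const z
  have h3 := h1.comp_of_eq t h2 rfl
  have h4 := hasDerivAt_spiral a 1 t
  simp only [mul_one] at h4
  have h5 := (hasDerivAt_phiInv (flow_arg_mem a hz ht)).comp_of_eq t (h4.mul h3) rfl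
  refine h5.congr_deriv ?_
  rw [(hasDerivAt_flow_left a hz ht).deriv]
  have h6 := deriv_phi_mul_spiralField (a := a) hw
  rw [spiralField, herglotz] at h6
  have h7 : (driving a t + z) / (driving a t - z)
      = (1 + (driving a t)⁻¹ * z) / (1 - (driving a t)⁻¹ * z) := by
    have h0 := driving_ne_zero a t
    rw [← mul_div_mul_left (1 + _) (1 - _) h0, mul_add, mul_sub, mul_one,
      mul_inv_cancel_left₀ h0]
  rw [h7]
  change (deriv (phi a) (flow a z t))⁻¹ * (_ * _ * phi a ((driving a t)⁻¹ * z) + _) = _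
  linear_combination (-(deriv (phi a) (flow a z t))⁻¹ *
    Complex.exp ((Complex.I * a - 1) * t)) * h6

theorem isLoewnerFlow_flow (a : ℝ) : IsLoewnerFlow (driving a) (flow a) where
  continuousOn := by
    refine (differentiableOn_phiInv a).continuousOn.comp (ContinuousOn.mul (by fun_prop)
      ((differentiableOn_phi a).continuousOn.comp (ContinuousOn.mul ?_ continuousOn_fst) ?_)) ?_
    · exact (((continuous_driving a).comp continuous_snd).inv₀
        fun _ => driving_ne_zero a _).continuousOn
    · exact fun p hp => inv_driving_mul_mem hp.1 a p.2
    · exact fun p hp => flow_arg_mem a hp.1 hp.2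
  holomorphic := fun t ht z hz =>
    (hasDerivAt_flow_left a hz ht).differentiableAt.differentiableWithinAt
  initial := fun z hz => by
    have h : driving a 0 = 1 := by simp [driving]
    simp [flow, orbit, h, phiInv_phi hz]
  equation := fun z hz t ht => (hasDerivAt_flow_right a hz ht).hasDerivWithinAt

/-- The radial Loewner equation has no other solution: along the characteristic through `(z, t)`,
which is a spiral in the image of `φ_a` run backwards in a rotating frame, every solution is
constant. -/
theorem IsLoewnerFlow.eq_flow {a : ℝ} {f : ℂ → ℝ → ℂ} (hf : IsLoewnerFlow (driving a) f)
    {z : ℂ} (hz : z ∈ disc) {t : ℝ} (ht : 0 ≤ t) : f z t = flow a z t := by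
  have hw := inv_driving_mul_mem hz a t
  set v := phi a ((driving a t)⁻¹ * z) with hv
  have hmem : ∀ s ≤ t, Complex.exp ((Complex.I * a - 1) * (t - s : ℝ)) * v ∈ phi a '' disc :=
    fun s hs => spiral_mem (mem_image_of_mem _ hw) (sub_nonneg.mpr hs)
  let Z : ℝ → ℂ := fun s => driving a s * orbit a v (t - s)
  have hZmem : ∀ s ≤ t, Z s ∈ disc := fun s hs => driving_mul_mem (phiInv_mem (hmem s hs)) a s
  have hZ : ∀ s ≤ t, HasDerivAt Z (Z s * ((driving a s + Z s) / (driving a s - Z s))) s := by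
    intro s hs
    have h1 : HasDerivAt (fun s => orbit a v (t - s)) (-spiralField a (orbit a v (t - s))) s := by
      have h := HasDerivAt.scomp s (hasDerivAt_orbit (hmem s hs)) ((hasDerivAt_id s).const_sub t)
      rw [neg_one_smul] at h
      exact h
    refine ((hasDerivAt_driving a s).mul h1).congr_deriv ?_
    have h2 : (driving a s + Z s) / (driving a s - Z s)
        = (1 + orbit a v (t - s)) / (1 - orbit a v (t - s)) := by
      rw [← mul_div_mul_left (1 + _) (1 - _) (driving_ne_zero a s), mul_add, mul_sub, mul_one]
    rw [h2, spiralField, herglotz]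
    simp only [Z]
    ring
  have hconst : ∀ s ∈ Icc 0 t, HasDerivWithinAt (fun s => f (Z s) s) 0 (Ici 0) s := by
    intro s hs
    refine (hasDerivWithinAt_along isOpen_disc hf.continuousOn hf.holomorphic hs.1
      (hZmem s hs.2) (hZ s hs.2).hasDerivWithinAt
      (hf.equation _ (hZmem s hs.2) s hs.1)).congr_deriv ?_
    ring
  have key := constant_of_has_deriv_right_zero
    (fun s hs => (hconst s hs).continuousWithinAt.mono Icc_subset_Ici_self)
    (fun s hs => (hconst s (Ico_subset_Icc_self hs)).mono (Ici_subset_Ici.mpr hs.1))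
    t (right_mem_Icc.mpr ht)
  have hZt : Z t = z := by
    have h : orbit a v 0 = (driving a t)⁻¹ * z := by simp [orbit, hv, phiInv_phi hw]
    simp only [Z, sub_self, h]
    rw [mul_inv_cancel_left₀ (driving_ne_zero a t)]
  have hZ0 : Z 0 = flow a z t := by simp [Z, driving, flow, hv]
  rw [hZt, hf.initial _ (hZmem 0 ht), hZ0] at key
  exact key

theorem isDecreasingChain_flow (a : ℝ) : IsDecreasingChain (flow a) where
  holomorphic := (isLoewnerFlow_flow a).holomorphic
  univalent := fun t ht z hz w hw h => by
    have h1 : phi a (flow a z t) = phi a (flow a w t) := congrArg _ h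
    rw [phi_flow a hz ht, phi_flow a hw ht] at h1
    exact mul_left_cancel₀ (inv_ne_zero (driving_ne_zero a t))
      (injOn_phi a (inv_driving_mul_mem hz a t) (inv_driving_mul_mem hw a t)
        (mul_left_cancel₀ (Complex.exp_ne_zero _) h1))
  mapsTo := fun t ht z hz => flow_mem a hz ht
  map_zero := fun t _ => by simp [flow, orbit, phi_zero, phiInv_zero]
  deriv_zero_pos := fun t ht => by
    have h0 : (0 : ℂ) ∈ disc := by simp [mem_disc]
    have h1 : flow a 0 t = 0 := by simp [flow, orbit, phi_zero, phiInv_zero]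
    refine ⟨Real.exp (-t), Real.exp_pos _, ?_⟩
    rw [(hasDerivAt_flow_left a h0 ht).deriv, h1, mul_zero, mul_left_comm,
      inv_mul_cancel_left₀ (deriv_phi_ne_zero h0), driving, ← Complex.exp_neg, ← Complex.exp_add,
      Complex.ofReal_exp]
    congr 1
    push_cast
    ring
  decreasing := by
    rintro s t hs hst _ ⟨z, hz, rfl⟩
    have hv := mem_image_of_mem (phi a) (inv_driving_mul_mem hz a t)
    have hu := spiral_mem hv (sub_nonneg.mpr hst)
    have hm := phiInv_mem hu
    refine ⟨driving a s * orbit a (phi a ((driving a t)⁻¹ * z)) (t - s),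
      driving_mul_mem hm a s, ?_⟩
    simp only [flow]
    rw [inv_mul_cancel_left₀ (driving_ne_zero a s), orbit, orbit, phi_phiInv hu, ← mul_assoc,
      ← Complex.exp_add, orbit]
    congr 3
    push_cast
    ring

theorem IsDecreasingChain.congr {f g : ℂ → ℝ → ℂ} (hg : IsDecreasingChain g)
    (h : ∀ z ∈ disc, ∀ t : ℝ, 0 ≤ t → f z t = g z t) : IsDecreasingChain f where
  holomorphic := fun t ht => (hg.holomorphic t ht).congr fun z hz => h z hz t ht
  univalent := fun t ht => (hg.univalent t ht).congr fun z hz => (h z hz t ht).symm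
  mapsTo := fun t ht => (hg.mapsTo t ht).congr fun z hz => (h z hz t ht).symm
  map_zero := fun t ht => by rw [h 0 (by simp [mem_disc]) t ht, hg.map_zero t ht]
  deriv_zero_pos := fun t ht => by
    have he : (fun z => f z t) =ᶠ[𝓝 0] fun z => g z t := by
      filter_upwards [isOpen_disc.mem_nhds (show (0 : ℂ) ∈ disc by simp [mem_disc])] with z hz
      exact h z hz t ht
    rw [he.deriv_eq]
    exact hg.deriv_zero_pos t ht
  decreasing := fun s t hs hst => by
    rw [image_congr fun z hz => h z hz t (hs.trans hst), image_congr fun z hz => h z hz s hs]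
    exact hg.decreasing s t hs hst

/-! ### The spiral from the boundary point `1` -/

/-- The critical value `φ_a(1)` is the tip of the spiral that bounds `φ_a(𝔻)`: since `φ_a` has a
simple critical point at `1`, the spiral `s ↦ φ_a(1) e^{(ia-1)s²}` lifts through `φ_a` to a
holomorphic curve that leaves `1` with velocity `-2`. -/
theorem exists_tip_lift (a : ℝ) : ∃ g : ℂ → ℂ, AnalyticAt ℂ g 0 ∧ g 0 = 1 ∧
    HasDerivAt g (-2) 0 ∧
    ∀ᶠ s in 𝓝 0, phi a (g s) = Complex.exp ((Complex.I * a - 1) * s ^ 2) * phi a 1 := by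
  have hk : (Complex.I * a - 1 : ℂ) ≠ 0 := by
    rw [← neg_sub]; exact neg_ne_zero.mpr (one_sub_I_mul_ne_zero a)
  -- `T z` is the time at which the spiral from `φ_a(1)` passes through `φ_a(z)`. It has a double
  -- zero at `1` with `T''(1) = 1/2`; the root `-1/2` of `T''(1)/2` makes the lift enter the disc.
  let T : ℂ → ℂ := fun z => (Complex.log z + exponent a z - exponent a 1) / (Complex.I * a - 1)
  let Ω : Set ℂ := branchDomain a ∩ Complex.slitPlane
  have hΩ : IsOpen Ω := (isOpen_branchDomain a).inter Complex.isOpen_slitPlane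
  have h1Ω : Ω ∈ 𝓝 (1 : ℂ) :=
    hΩ.mem_nhds ⟨one_mem_branchDomain a, Complex.one_mem_slitPlane⟩
  have hT : ∀ z ∈ Ω, HasDerivAt T (b a * (1 - z) / (z * (z + b a) * (Complex.I * a - 1))) z := by
    intro z hz
    have h := (((Complex.hasDerivAt_log hz.2).add (hasDerivAt_exponent hz.1)).sub_const
      (exponent a 1)).div_const (Complex.I * a - 1)
    refine h.congr_deriv ?_
    have h1 := add_b_ne_zero hz.1
    have h2 := Complex.slitPlane_ne_zero hz.2
    field_simp
    ring
  have hTa : AnalyticAt ℂ T 1 := DifferentiableOn.analyticAt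
    (fun z hz => (hT z hz).differentiableAt.differentiableWithinAt) h1Ω
  have hb1 := add_b_ne_zero (one_mem_branchDomain a)
  have hT2 : HasDerivAt (deriv T) (2 * (-(1 / 2 : ℂ)) ^ 2) 1 := by
    have he : deriv T =ᶠ[𝓝 1]
        fun z => b a * (1 - z) / (z * (z + b a) * (Complex.I * a - 1)) := by
      filter_upwards [h1Ω] with z hz using (hT z hz).deriv
    have hq : HasDerivAt (fun z => b a * (1 - z) / (z * (z + b a) * (Complex.I * a - 1)))
        _ 1 :=
      (((hasDerivAt_id (1 : ℂ)).const_sub 1).const_mul (b a)).div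
        (((hasDerivAt_id (1 : ℂ)).mul ((hasDerivAt_id (1 : ℂ)).add_const (b a))).mul_const
          (Complex.I * a - 1)) (by simpa using ⟨hb1, hk⟩)
    refine (hq.congr_of_eventuallyEq he).congr_deriv ?_
    simp only [id]
    field_simp
    linear_combination -(1 + b a) * b_mul a
  obtain ⟨g, hga, hg0, hg', hg⟩ := exists_sq_parametrization hTa (by simp [T])
    (by rw [(hT 1 (mem_of_mem_nhds h1Ω)).deriv]; simp) (by norm_num) hT2
  refine ⟨g, hga, hg0, hg'.congr_deriv (by norm_num), ?_⟩
  have hne : ∀ᶠ s in 𝓝 0, g s ≠ 0 := hga.continuousAt.eventually_ne (by simp [hg0])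
  filter_upwards [hg, hne] with s hs h0
  have h1 : Complex.log (g s) + exponent a (g s)
      = (Complex.I * a - 1) * s ^ 2 + exponent a 1 := by
    rw [← hs]
    simp only [T]
    field_simp
    ring
  rw [phi_eq, phi_eq, one_mul, ← Complex.exp_add, ← h1, Complex.exp_add, Complex.exp_log h0]

/-- A curve that leaves `1` with velocity `-2` enters the disc. -/
theorem eventually_mem_disc {g : ℂ → ℂ} (hg0 : g 0 = 1) (hg : HasDerivAt g (-2) 0) :
    ∀ᶠ s : ℝ in 𝓝[>] 0, g s ∈ disc := by
  have h1 : HasDerivAt (fun s : ℝ => ‖g s‖ ^ 2) (2 * inner ℝ (g (0 : ℝ)) (-2)) 0 :=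
    (HasDerivAt.comp_ofReal (z := 0) (by simpa using hg)).norm_sq
  have h2 : (2 * inner ℝ (g (0 : ℝ)) (-2) : ℝ) = -4 := by
    simp [hg0, Complex.inner]; norm_num
  rw [h2, hasDerivAt_iff_tendsto_slope] at h1
  have h3 := (h1.eventually (gt_mem_nhds (show (-4 : ℝ) < 0 by norm_num))).filter_mono
    (nhdsWithin_mono 0 fun x (hx : 0 < x) => hx.ne')
  filter_upwards [h3, self_mem_nhdsWithin] with s hs hs0
  rw [slope_def_field, sub_zero, Complex.ofReal_zero, hg0, norm_one, one_pow] at hs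
  have h4 : ‖g s‖ ^ 2 < 1 := by
    have := (div_lt_iff₀ (show (0 : ℝ) < s from hs0)).mp hs
    linarith
  rw [mem_disc]
  nlinarith [norm_nonneg (g s)]

theorem tip_spiral_mem (a : ℝ) {t : ℝ} (ht : 0 < t) :
    Complex.exp ((Complex.I * a - 1) * t) * phi a 1 ∈ phi a '' disc := by
  obtain ⟨g, hga, hg0, hg', hg⟩ := exists_tip_lift a
  have h1 : ∀ᶠ s : ℝ in 𝓝[>] 0, phi a (g s)
      = Complex.exp ((Complex.I * a - 1) * (s : ℂ) ^ 2) * phi a 1 :=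
    ((Complex.continuous_ofReal.tendsto' 0 0 Complex.ofReal_zero).eventually hg).filter_mono
      nhdsWithin_le_nhds
  have h2 : ∀ᶠ s : ℝ in 𝓝[>] 0, s ^ 2 < t :=
    (((continuous_pow 2).tendsto' (0 : ℝ) 0 (by simp)).eventually (gt_mem_nhds ht)).filter_mono
      nhdsWithin_le_nhds
  obtain ⟨s, ⟨hs1, hs2⟩, hs3⟩ := ((h1.and h2).and (eventually_mem_disc hg0 hg')).exists
  have h3 := spiral_mem (mem_image_of_mem (phi a) hs3) (sub_nonneg.mpr hs2.le)
  rw [hs1, ← mul_assoc, ← Complex.exp_add] at h3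
  convert h3 using 3
  push_cast
  ring

/-! ### The trace -/

/-- The trace: the lift through `φ_a` of the spiral from `φ_a(1)`, starting at `1`. -/
noncomputable def trace (a : ℝ) (t : ℝ) : ℂ := if t ≤ 0 then 1 else orbit a (phi a 1) t

theorem trace_zero (a : ℝ) : trace a 0 = 1 := by simp [trace]

theorem trace_of_pos (a : ℝ) {t : ℝ} (ht : 0 < t) : trace a t = orbit a (phi a 1) t := by
  simp [trace, ht]

theorem trace_mem (a : ℝ) {t : ℝ} (ht : 0 < t) : trace a t ∈ disc := by
  rw [trace_of_pos a ht]; exact phiInv_mem (tip_spiral_mem a ht)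

theorem phi_trace (a : ℝ) {t : ℝ} (ht : 0 ≤ t) :
    phi a (trace a t) = Complex.exp ((Complex.I * a - 1) * t) * phi a 1 := by
  rcases ht.eq_or_lt with rfl | h
  · simp [trace_zero]
  · rw [trace_of_pos a h]; exact phi_phiInv (tip_spiral_mem a h)

theorem phi_one_ne_zero (a : ℝ) : phi a 1 ≠ 0 := fun h => one_ne_zero (phi_eq_zero_iff.mp h)

theorem trace_ne_zero (a : ℝ) {t : ℝ} (ht : 0 ≤ t) : trace a t ≠ 0 := fun h => by
  have h1 := phi_trace a ht
  rw [h, phi_zero] at h1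
  exact mul_ne_zero (Complex.exp_ne_zero _) (phi_one_ne_zero a) h1.symm

theorem injOn_trace (a : ℝ) : InjOn (trace a) (Ici 0) := fun s hs t ht h => by
  have h1 := congrArg (phi a) h
  rw [phi_trace a hs, phi_trace a ht] at h1
  have h2 := congrArg norm (mul_right_cancel₀ (phi_one_ne_zero a) h1)
  rw [Complex.norm_exp, Complex.norm_exp, Real.exp_eq_exp] at h2
  simpa using h2

theorem trace_eventuallyEq (a : ℝ) {t : ℝ} (ht : 0 < t) :
    trace a =ᶠ[𝓝 t] orbit a (phi a 1) := by
  filter_upwards [lt_mem_nhds ht] with s hs using trace_of_pos a hs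

theorem hasDerivAt_trace (a : ℝ) {t : ℝ} (ht : 0 < t) :
    HasDerivAt (trace a) (spiralField a (trace a t)) t := by
  rw [trace_of_pos a ht]
  exact (hasDerivAt_orbit (tip_spiral_mem a ht)).congr_of_eventuallyEq (trace_eventuallyEq a ht)

theorem spiralField_trace_ne_zero (a : ℝ) {t : ℝ} (ht : 0 < t) :
    spiralField a (trace a t) ≠ 0 :=
  neg_ne_zero.mpr (mul_ne_zero (trace_ne_zero a ht.le) (herglotz_ne_zero a (trace_mem a ht)))

theorem contDiffAt_trace (a : ℝ) {t : ℝ} (ht : 0 < t) : ContDiffAt ℝ (⊤ : ℕ∞) (trace a) t := by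
  refine ContDiffAt.congr_of_eventuallyEq ?_ (trace_eventuallyEq a ht)
  have h1 : ContDiffAt ℂ (⊤ : ℕ∞) (phiInv a)
      (Complex.exp ((Complex.I * a - 1) * t) * phi a 1) :=
    ((differentiableOn_phiInv a).contDiffOn (isOpen_image_phi a)).contDiffAt
      ((isOpen_image_phi a).mem_nhds (tip_spiral_mem a ht))
  refine ContDiffAt.comp t (h1.restrict_scalars ℝ) ?_
  exact (((contDiffAt_const.mul Complex.ofRealCLM.contDiff.contDiffAt).cexp).mul contDiffAt_const)

theorem trace_sq_eventuallyEq {a : ℝ} {g : ℂ → ℂ} (hg0 : g 0 = 1) (hg' : HasDerivAt g (-2) 0)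
    (hg : ∀ᶠ s in 𝓝 0, phi a (g s) = Complex.exp ((Complex.I * a - 1) * s ^ 2) * phi a 1) :
    (fun s : ℝ => trace a (s ^ 2)) =ᶠ[𝓝[≥] 0] fun s : ℝ => g s := by
  have h1 : ∀ᶠ s : ℝ in 𝓝[≥] 0, phi a (g s)
      = Complex.exp ((Complex.I * a - 1) * (s : ℂ) ^ 2) * phi a 1 :=
    ((Complex.continuous_ofReal.tendsto' 0 0 Complex.ofReal_zero).eventually hg).filter_mono
      nhdsWithin_le_nhds
  have h2 : ∀ᶠ s : ℝ in 𝓝[≥] 0, 0 < s → g s ∈ disc := by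
    have := eventually_nhdsWithin_iff.mp (eventually_mem_disc hg0 hg')
    exact this.filter_mono nhdsWithin_le_nhds
  filter_upwards [h1, h2, self_mem_nhdsWithin] with s hs1 hs2 hs
  rcases (show (0 : ℝ) ≤ s from hs).eq_or_lt with rfl | hs0
  · simp [trace_zero, hg0]
  · refine injOn_phi a (trace_mem a (by positivity)) (hs2 hs0) ?_
    rw [hs1, phi_trace a (by positivity)]
    push_cast
    rfl

theorem isSmoothCurve_trace (a : ℝ) : IsSmoothCurve (trace a) := by
  obtain ⟨g, hga, hg0, hg', hg⟩ := exists_tip_lift a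
  have he := trace_sq_eventuallyEq hg0 hg' hg
  refine ⟨injOn_trace a, fun t ht => (contDiffAt_trace a ht).contDiffWithinAt,
    fun t ht => ?_, fun s hs => ?_, ?_⟩
  · rw [(hasDerivAt_trace a ht).deriv]
    exact spiralField_trace_ne_zero a ht
  · rcases (show (0 : ℝ) ≤ s from hs).eq_or_lt with rfl | hs0
    · refine ContDiffWithinAt.congr_of_eventuallyEq ?_ he (by simp [trace_zero, hg0])
      have h1 : ContDiffAt ℂ (⊤ : ℕ∞) g ((0 : ℝ) : ℂ) := by
        rw [Complex.ofReal_zero]; exact hga.contDiffAt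
      exact (ContDiffAt.comp (0 : ℝ) (h1.restrict_scalars ℝ)
        Complex.ofRealCLM.contDiff.contDiffAt).contDiffWithinAt
    · exact (ContDiffAt.comp s (f := fun s : ℝ => s ^ 2) (contDiffAt_trace a (pow_pos hs0 2))
        (contDiff_id.pow 2).contDiffAt).contDiffWithinAt
  · have h1 : HasDerivWithinAt (fun s : ℝ => g s) (-2) (Ici 0) 0 :=
      (HasDerivAt.comp_ofReal (z := 0) (by simpa using hg')).hasDerivWithinAt
    rw [(h1.congr_of_eventuallyEq he (by simp [trace_zero, hg0])).derivWithin
      (uniqueDiffOn_Ici 0 0 self_mem_Ici)]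
    norm_num

theorem tendsto_sqrt_nhdsGT_zero : Tendsto Real.sqrt (𝓝[>] 0) (𝓝[>] 0) := by
  refine tendsto_nhdsWithin_iff.mpr ⟨?_, ?_⟩
  · exact (Real.continuous_sqrt.tendsto' 0 0 Real.sqrt_zero).mono_left nhdsWithin_le_nhds
  · filter_upwards [self_mem_nhdsWithin] with t ht using Real.sqrt_pos.mpr ht

/-- `1 - γ(t)` is asymptotic to `2 √t`. -/
theorem tendsto_one_sub_trace_div_sqrt (a : ℝ) :
    Tendsto (fun t => (1 - trace a t) / (Real.sqrt t : ℂ)) (𝓝[>] 0) (𝓝 2) := by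
  obtain ⟨g, hga, hg0, hg', hg⟩ := exists_tip_lift a
  have he := trace_sq_eventuallyEq hg0 hg' hg
  have h1 : HasDerivAt (fun s : ℝ => g s) (-2) 0 :=
    HasDerivAt.comp_ofReal (z := 0) (by simpa using hg')
  have h2 := (hasDerivAt_iff_tendsto_slope.mp h1).mono_left
    (nhdsWithin_mono 0 fun x (hx : 0 < x) => hx.ne')
  have h3 : Tendsto (fun s : ℝ => (1 - trace a (s ^ 2)) / (s : ℂ)) (𝓝[>] 0) (𝓝 2) := by
    have h4 := h2.neg
    rw [neg_neg] at h4
    refine h4.congr' ?_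
    filter_upwards [he.filter_mono (nhdsWithin_mono 0 Ioi_subset_Ici_self)] with s hs
    rw [hs, slope_def_module, sub_zero, Complex.ofReal_zero, hg0, Complex.real_smul,
      Complex.ofReal_inv]
    ring
  refine (h3.comp tendsto_sqrt_nhdsGT_zero).congr' ?_
  filter_upwards [self_mem_nhdsWithin] with t ht
  simp only [Function.comp_apply, Real.sq_sqrt (show (0 : ℝ) ≤ t from (show 0 < t from ht).le)]

theorem tendsto_trace_zero (a : ℝ) : Tendsto (trace a) (𝓝[>] 0) (𝓝 1) := by
  have h1 : Tendsto (fun t : ℝ => (Real.sqrt t : ℂ)) (𝓝[>] 0) (𝓝 0) :=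
    ((Complex.continuous_ofReal.comp Real.continuous_sqrt).tendsto' 0 0 (by simp)).mono_left
      nhdsWithin_le_nhds
  have h2 := ((tendsto_one_sub_trace_div_sqrt a).mul h1).const_sub 1
  rw [mul_zero, sub_zero] at h2
  refine h2.congr' ?_
  filter_upwards [self_mem_nhdsWithin] with t ht
  have h3 : (Real.sqrt t : ℂ) ≠ 0 :=
    Complex.ofReal_ne_zero.mpr (Real.sqrt_pos.mpr ht).ne'
  rw [div_mul_cancel₀ _ h3, sub_sub_cancel]

theorem continuousOn_trace (a : ℝ) : ContinuousOn (trace a) (Ici 0) := fun t ht => by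
  rcases (show (0 : ℝ) ≤ t from ht).eq_or_lt with rfl | h
  · rw [← Ioi_insert, continuousWithinAt_insert_self, ContinuousWithinAt, trace_zero]
    exact tendsto_trace_zero a
  · exact (hasDerivAt_trace a h).continuousAt.continuousWithinAt

theorem startsPerpendicularly_trace (a : ℝ) : StartsPerpendicularly (trace a) where
  start := trace_zero a
  chord := by
    have h1 := ((Complex.continuousAt_arg (x := 2) (by simp)).tendsto.comp
      (tendsto_one_sub_trace_div_sqrt a))
    rw [show Complex.arg 2 = 0 by simp] at h1
    refine h1.congr' ?_
    filter_upwards [self_mem_nhdsWithin] with t ht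
    have h2 : 0 < (Real.sqrt t)⁻¹ := inv_pos.mpr (Real.sqrt_pos.mpr ht)
    rw [Function.comp_apply, div_eq_mul_inv, ← Complex.ofReal_inv, Complex.arg_mul_real h2]
  tangent := by
    -- `√t γ'(t) = -γ (1 + γ - ia(1 - γ)) / ((1 - γ) / √t)` tends to `-1`.
    let u : ℝ → ℂ := fun t => -(trace a t * (1 + trace a t - Complex.I * a * (1 - trace a t))) /
      ((1 - trace a t) / (Real.sqrt t : ℂ))
    have hγ := tendsto_trace_zero a
    have hu : Tendsto u (𝓝[>] 0) (𝓝 (-1)) := by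
      have h := ((hγ.mul ((hγ.const_add 1).sub ((hγ.const_sub 1).const_mul
        (Complex.I * a)))).neg).div (tendsto_one_sub_trace_div_sqrt a) two_ne_zero
      have e : -(1 * (1 + 1 - Complex.I * a * (1 - 1))) / 2 = (-1 : ℂ) := by ring
      rw [e] at h
      exact h
    have hn : Tendsto (fun t => u t / (‖u t‖ : ℂ)) (𝓝[>] 0) (𝓝 (-1)) := by
      have h := hu.div ((Complex.continuous_ofReal.tendsto _).comp hu.norm) (by simp)
      rw [norm_neg, norm_one, Complex.ofReal_one, div_one] at h
      exact h
    refine hn.congr' ?_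
    filter_upwards [self_mem_nhdsWithin] with t ht
    have h1 : (1 - trace a t) ≠ 0 := sub_ne_zero.mpr (ne_one_of_mem_disc (trace_mem a ht)).symm
    have hs : 0 < Real.sqrt t := Real.sqrt_pos.mpr ht
    have hs' : (Real.sqrt t : ℂ) ≠ 0 := Complex.ofReal_ne_zero.mpr hs.ne'
    have h2 : u t = (Real.sqrt t : ℂ) * spiralField a (trace a t) := by
      simp only [u, spiralField, herglotz]
      field_simp
    rw [(hasDerivAt_trace a ht).deriv, h2, norm_mul, Complex.norm_real, Real.norm_eq_abs,
      abs_of_pos hs, Complex.ofReal_mul, mul_div_mul_left _ _ hs']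

theorem continuousAt_phi_one (a : ℝ) : ContinuousAt (phi a) 1 :=
  (hasDerivAt_phi (one_mem_branchDomain a)).continuousAt

theorem continuousAt_phiInv {a : ℝ} {v : ℂ} (hv : v ∈ phi a '' disc) :
    ContinuousAt (phiInv a) v := (hasDerivAt_phiInv hv).continuousAt

theorem tendsto_orbit_tip (a : ℝ) {t : ℝ} (ht : 0 < t) :
    Tendsto (fun w => orbit a (phi a w) t) (𝓝 1) (𝓝 (trace a t)) := by
  rw [trace_of_pos a ht]
  exact (continuousAt_phiInv (tip_spiral_mem a ht)).tendsto.comp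
    ((continuousAt_phi_one a).tendsto.const_mul _)

theorem isTrace_trace {a : ℝ} {f : ℂ → ℝ → ℂ} (hf : IsLoewnerFlow (driving a) f) :
    IsTrace (driving a) f (trace a) := fun t ht => by
  rcases ht.eq_or_lt with rfl | h
  · have h1 : driving a 0 = 1 := by simp [driving]
    rw [h1, trace_zero]
    refine (tendsto_id.mono_left nhdsWithin_le_nhds).congr' ?_
    filter_upwards [self_mem_nhdsWithin] with z hz using (hf.initial z hz).symm
  · have h1 : Tendsto (fun z => (driving a t)⁻¹ * z) (𝓝[disc] (driving a t)) (𝓝 1) :=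
      ((continuous_const_mul _).tendsto' _ _
        (inv_mul_cancel₀ (driving_ne_zero a t))).mono_left nhdsWithin_le_nhds
    refine ((tendsto_orbit_tip a h).comp h1).congr' ?_
    filter_upwards [self_mem_nhdsWithin] with z hz using (hf.eq_flow hz ht).symm

theorem IsTrace.eq {a : ℝ} {f : ℂ → ℝ → ℂ} {γ δ : ℝ → ℂ} (hγ : IsTrace (driving a) f γ)
    (hδ : IsTrace (driving a) f δ) {t : ℝ} (ht : 0 ≤ t) : γ t = δ t := by
  have : (𝓝[disc] (driving a t)).NeBot := by
    rw [← mem_closure_iff_nhdsWithin_neBot, disc, closure_ball _ one_ne_zero]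
    simp [norm_driving]
  exact tendsto_nhds_unique (hγ t ht) (hδ t ht)

/-! ### Reflection in the real line -/

/-- Since `b ≠ -1`, the principal logarithm of `b` is compatible with conjugation. -/
theorem b_mem_slitPlane (a : ℝ) : b a ∈ Complex.slitPlane := by
  rw [Complex.mem_slitPlane_iff]
  by_cases ha : a = 0
  · left; simp [b, ha]
  · right
    rw [b, Complex.div_im]
    simp [Complex.normSq_apply]
    have : (1 + a * a) ≠ 0 := by nlinarith [mul_self_nonneg a]
    field_simp
    norm_num [ha]

theorem b_neg (a : ℝ) : b (-a) = starRingEnd ℂ (b a) := by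
  simp [b, sub_eq_add_neg]

theorem phi_neg_conj {a : ℝ} {z : ℂ} (hz : z ∈ branchDomain a) :
    phi (-a) (starRingEnd ℂ z) = starRingEnd ℂ (phi a z) := by
  have h1 : (1 : ℂ) + starRingEnd ℂ z / starRingEnd ℂ (b a)
      = starRingEnd ℂ (1 + z / b a) := by simp
  have h2 : logBranch (-a) (starRingEnd ℂ z) = starRingEnd ℂ (logBranch a z) := by
    rw [logBranch, logBranch, b_neg, h1, Complex.log_conj _ (Complex.slitPlane_arg_ne_pi hz),
      Complex.log_conj _ (Complex.slitPlane_arg_ne_pi (b_mem_slitPlane a)), map_add]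
  rw [phi, phi, h2, b_neg, map_mul, ← Complex.exp_conj]
  simp

theorem trace_neg (a : ℝ) {t : ℝ} (ht : 0 ≤ t) : trace (-a) t = starRingEnd ℂ (trace a t) := by
  rcases ht.eq_or_lt with rfl | h
  · simp [trace_zero]
  · have hm := trace_mem a h
    refine injOn_phi (-a) (trace_mem (-a) h) ?_ ?_
    · rw [mem_disc, RCLike.norm_conj]; exact mem_disc.mp hm
    · have h1 := phi_neg_conj (one_mem_branchDomain a)
      rw [map_one] at h1
      rw [phi_neg_conj (disc_subset_branchDomain a hm), phi_trace a ht, phi_trace (-a) ht, h1,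
        map_mul, ← Complex.exp_conj]
      simp

/-! ### The polar form of the trace -/

/-- A continuous logarithm of the trace, vanishing at `t = 0`. -/
noncomputable def traceLog (a t : ℝ) : ℂ :=
  exponent a 1 - exponent a (trace a t) + (Complex.I * a - 1) * t

theorem exp_traceLog (a : ℝ) {t : ℝ} (ht : 0 ≤ t) : Complex.exp (traceLog a t) = trace a t := by
  have h := phi_trace a ht
  rw [phi_eq, phi_eq, one_mul] at h
  rw [traceLog, Complex.exp_add, Complex.exp_sub, div_mul_eq_mul_div,
    div_eq_iff (Complex.exp_ne_zero _), h, mul_comm]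

theorem traceLog_zero (a : ℝ) : traceLog a 0 = 0 := by simp [traceLog, trace_zero]

theorem trace_mem_branchDomain (a : ℝ) {t : ℝ} (ht : 0 ≤ t) : trace a t ∈ branchDomain a := by
  rcases ht.eq_or_lt with rfl | h
  · rw [trace_zero]; exact one_mem_branchDomain a
  · exact disc_subset_branchDomain a (trace_mem a h)

theorem continuousOn_traceLog (a : ℝ) : ContinuousOn (traceLog a) (Ici 0) := by
  have h : ContinuousOn (fun t => exponent a (trace a t)) (Ici 0) := fun t ht =>
    (hasDerivAt_exponent (trace_mem_branchDomain a ht)).continuousAt.comp_continuousWithinAt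
      (continuousOn_trace a t ht)
  exact (continuousOn_const.sub h).add (by fun_prop)

theorem hasDerivAt_traceLog (a : ℝ) {t : ℝ} (ht : 0 < t) :
    HasDerivAt (traceLog a) (-herglotz a (trace a t)) t := by
  have hd := trace_mem_branchDomain a ht.le
  have h1 := (hasDerivAt_exponent hd).comp_of_eq t (hasDerivAt_trace a ht) rfl
  have h2 : HasDerivAt (fun s : ℝ => (Complex.I * a - 1) * (s : ℂ)) (Complex.I * a - 1) t := by
    simpa using ((hasDerivAt_id (t : ℂ)).const_mul (Complex.I * a - 1)).comp_ofReal
  refine ((h1.const_sub (exponent a 1)).add h2).congr_deriv ?_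
  have h3 := logDeriv_mul_herglotz hd (ne_one_of_mem_disc (trace_mem a ht))
  have h4 := add_b_ne_zero hd
  rw [spiralField]
  field_simp at h3 ⊢
  linear_combination h3

theorem tendsto_trace_atTop (a : ℝ) : Tendsto (trace a) atTop (𝓝 0) := by
  have h0 : (0 : ℂ) ∈ phi a '' disc := ⟨0, by simp [mem_disc], phi_zero a⟩
  have h1 : Tendsto (fun t : ℝ => Complex.exp ((Complex.I * a - 1) * t) * phi a 1) atTop (𝓝 0) := by
    have h2 : Tendsto (fun t : ℝ => Complex.exp ((Complex.I * a - 1) * t)) atTop (𝓝 0) := by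
      rw [Complex.tendsto_exp_nhds_zero_iff]
      simpa using tendsto_neg_atTop_atBot
    simpa using h2.mul_const (phi a 1)
  have h3 := (continuousAt_phiInv h0).tendsto.comp h1
  rw [phiInv_zero] at h3
  refine h3.congr' ?_
  filter_upwards [eventually_gt_atTop 0] with t ht using (trace_of_pos a ht).symm

theorem norm_trace (a : ℝ) {t : ℝ} (ht : 0 ≤ t) :
    ‖trace a t‖ = Real.exp (traceLog a t).re := by
  rw [← exp_traceLog a ht, Complex.norm_exp]

theorem hasDerivAt_re {f : ℝ → ℂ} {f' : ℂ} {t : ℝ} (h : HasDerivAt f f' t) :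
    HasDerivAt (fun s => (f s).re) f'.re t :=
  Complex.reCLM.hasFDerivAt.comp_hasDerivAt t h

theorem hasDerivAt_im {f : ℝ → ℂ} {f' : ℂ} {t : ℝ} (h : HasDerivAt f f' t) :
    HasDerivAt (fun s => (f s).im) f'.im t :=
  Complex.imCLM.hasFDerivAt.comp_hasDerivAt t h

theorem isPolarForm_trace (a : ℝ) :
    IsPolarForm (trace a) (fun t => ‖trace a t‖) (fun t => (traceLog a t).im) where
  eq := fun t ht => by
    rw [norm_trace a ht, Complex.ofReal_exp, ← Complex.exp_add, mul_comm Complex.I,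
      Complex.re_add_im, exp_traceLog a ht]
  r_pos := fun t ht => norm_pos_iff.mpr (trace_ne_zero a ht)
  r_anti := by
    have h : StrictAntiOn (fun t => (traceLog a t).re) (Ici 0) := by
      refine strictAntiOn_of_deriv_neg (convex_Ici 0)
        (Complex.continuous_re.comp_continuousOn (continuousOn_traceLog a)) fun t ht => ?_
      rw [interior_Ici] at ht
      rw [(hasDerivAt_re (hasDerivAt_traceLog a ht)).deriv, Complex.neg_re, neg_lt_zero]
      exact herglotz_re_pos a (trace_mem a ht)
    intro s hs t ht hst
    simp only [norm_trace a hs, norm_trace a ht]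
    exact Real.exp_lt_exp.mpr (h hs ht hst)
  r_tendsto := by simpa using (tendsto_trace_atTop a).norm
  r_continuousOn := (continuousOn_trace a).norm
  angle_continuousOn := Complex.continuous_im.comp_continuousOn (continuousOn_traceLog a)
  angle_zero := by simp [traceLog_zero]

theorem hasDerivAt_angle (a : ℝ) {t : ℝ} (ht : 0 < t) :
    HasDerivAt (fun t => (traceLog a t).im)
      (a - ((1 + trace a t) / (1 - trace a t)).im) t := by
  refine (hasDerivAt_im (hasDerivAt_traceLog a ht)).congr_deriv ?_
  simp [herglotz]

/-- The angle is `at` up to a convergent term. -/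
theorem tendsto_angle_sub (a : ℝ) :
    Tendsto (fun t => (exponent a 1 - exponent a (trace a t)).im) atTop
      (𝓝 (exponent a 1 - exponent a 0).im) := by
  have h0 : (0 : ℂ) ∈ branchDomain a := disc_subset_branchDomain a (by simp [mem_disc])
  exact (Complex.continuous_im.tendsto _).comp
    (((hasDerivAt_exponent h0).continuousAt.tendsto.comp (tendsto_trace_atTop a)).const_sub _)

theorem angle_eq (a t : ℝ) :
    (traceLog a t).im = (exponent a 1 - exponent a (trace a t)).im + a * t := by
  simp [traceLog]

/-! ### Monotonicity of the angle -/

/-- The flow in the half-plane coordinate `c = (1 + z) / (1 - z)`. -/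
theorem hasDerivAt_cayley {a : ℝ} {y : ℝ → ℂ} {t : ℝ} (hy : y t ∈ disc)
    (h : HasDerivAt y (spiralField a (y t)) t) :
    HasDerivAt (fun s => (1 + y s) / (1 - y s))
      (-((((1 + y t) / (1 - y t)) ^ 2 - 1) * ((1 + y t) / (1 - y t) - Complex.I * a) / 2)) t := by
  have h1 : 1 - y t ≠ 0 := sub_ne_zero.mpr (ne_one_of_mem_disc hy).symm
  refine ((h.const_add 1).div (h.const_sub 1) h1).congr_deriv ?_
  rw [spiralField, herglotz]
  field_simp
  ring

/-- On the line `Im c = a` the flow points, with a strict inequality, towards the side of the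
real axis. -/
theorem cayley_field_im {a : ℝ} {c : ℂ} (hc : c.im = a) :
    (-((c ^ 2 - 1) * (c - Complex.I * a) / 2)).im = -(a * c.re ^ 2) := by
  have h : c - Complex.I * a = (c.re : ℂ) := by
    apply Complex.ext <;> simp [hc]
  rw [h, Complex.neg_im, Complex.div_ofNat_im, Complex.im_mul_ofReal]
  simp [sq, hc]
  ring

theorem cayley_re_pos {z : ℂ} (hz : z ∈ disc) : 0 < ((1 + z) / (1 - z)).re := by
  have h := herglotz_re_pos 0 hz
  simpa [herglotz] using h

/-- The orbits that start on the real axis stay on one side of the line `Im c = a`. -/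
theorem cayley_orbit_im_le {a : ℝ} (ha : a ≠ 0) {x : ℝ} (hx0 : 0 < x) (hx1 : x < 1) {t : ℝ}
    (ht : 0 ≤ t) :
    a * ((1 + orbit a (phi a x) t) / (1 - orbit a (phi a x) t)).im ≤ a ^ 2 := by
  have hx : (x : ℂ) ∈ disc := by
    rw [mem_disc, Complex.norm_real, Real.norm_eq_abs, abs_of_pos hx0]; exact hx1
  have hmem : ∀ s, 0 ≤ s → orbit a (phi a x) s ∈ disc := fun s hs =>
    phiInv_mem (spiral_mem (mem_image_of_mem _ hx) hs)
  have hder := fun s (hs : 0 ≤ s) => (hasDerivAt_im (hasDerivAt_cayley (hmem s hs)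
    (hasDerivAt_orbit (spiral_mem (mem_image_of_mem _ hx) hs)))).const_mul a
  refine image_le_of_deriv_right_lt_deriv_boundary (a := 0) (b := t) (B := fun _ => a ^ 2)
    (B' := fun _ => 0)
    (fun s hs => (hder s hs.1).continuousAt.continuousWithinAt)
    (fun s hs => (hder s hs.1).hasDerivWithinAt) ?_ (fun s => hasDerivAt_const s _) ?_
    (right_mem_Icc.mpr ht)
  · have h0 : orbit a (phi a x) 0 = x := by simp [orbit, phiInv_phi hx]
    rw [h0]
    have : ((1 + x) / (1 - x) : ℂ) = ((1 + x) / (1 - x) : ℝ) := by push_cast; rfl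
    rw [this, Complex.ofReal_im, mul_zero]
    positivity
  · intro s hs h
    have h1 := mul_left_cancel₀ ha (h.trans (sq a))
    have h2 := cayley_re_pos (hmem s hs.1)
    rw [cayley_field_im h1]
    have : 0 < a ^ 2 * ((1 + orbit a (phi a x) s) / (1 - orbit a (phi a x) s)).re ^ 2 := by
      positivity
    linarith

theorem cayley_trace_im_le {a : ℝ} (ha : a ≠ 0) {t : ℝ} (ht : 0 < t) :
    a * ((1 + trace a t) / (1 - trace a t)).im ≤ a ^ 2 := by
  have h1 : Tendsto (fun x : ℝ => orbit a (phi a x) t) (𝓝[<] 1) (𝓝 (trace a t)) :=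
    (tendsto_orbit_tip a ht).comp ((Complex.continuous_ofReal.tendsto' 1 1
      Complex.ofReal_one).mono_left nhdsWithin_le_nhds)
  have h2 : 1 - trace a t ≠ 0 := sub_ne_zero.mpr (ne_one_of_mem_disc (trace_mem a ht)).symm
  have h3 := (((Complex.continuous_im.tendsto _).comp
    ((h1.const_add 1).div (h1.const_sub 1) h2))).const_mul a
  refine le_of_tendsto h3 ?_
  filter_upwards [self_mem_nhdsWithin,
    nhdsWithin_le_nhds (lt_mem_nhds (show (0 : ℝ) < 1 from zero_lt_one))] with x hx1 hx0
  exact cayley_orbit_im_le ha hx0 hx1 ht.le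

/-- The trace lies strictly on one side of the line `Im c = a`: a point of contact would be a
maximum of `a Im c` along the trace, where the derivative does not vanish. -/
theorem mul_angle_deriv_pos {a : ℝ} (ha : a ≠ 0) {t : ℝ} (ht : 0 < t) :
    0 < a * (a - ((1 + trace a t) / (1 - trace a t)).im) := by
  have hle := cayley_trace_im_le ha ht
  by_contra hcon
  have heq : a * ((1 + trace a t) / (1 - trace a t)).im = a ^ 2 := by
    refine le_antisymm hle ?_
    nlinarith [not_lt.mp hcon]
  have hd := (hasDerivAt_im (hasDerivAt_cayley (trace_mem a ht) (hasDerivAt_trace a ht))).const_mul a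
  have hmax : IsLocalMax (fun s => a * ((1 + trace a s) / (1 - trace a s)).im) t := by
    filter_upwards [lt_mem_nhds ht] with s hs
    rw [heq]
    exact cayley_trace_im_le ha hs
  have h0 := hmax.hasDerivAt_eq_zero hd
  rw [cayley_field_im (mul_left_cancel₀ ha (heq.trans (sq a)))] at h0
  have h2 := cayley_re_pos (trace_mem a ht)
  have : 0 < a ^ 2 * ((1 + trace a t) / (1 - trace a t)).re ^ 2 := by positivity
  linarith

theorem angle_of_pos {a : ℝ} (ha : 0 < a) :
    StrictMonoOn (fun t => (traceLog a t).im) (Ici 0) ∧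
      Tendsto (fun t => (traceLog a t).im) atTop atTop := by
  constructor
  · refine strictMonoOn_of_deriv_pos (convex_Ici 0)
      (isPolarForm_trace a).angle_continuousOn fun t ht => ?_
    rw [interior_Ici] at ht
    rw [(hasDerivAt_angle a ht).deriv]
    exact pos_of_mul_pos_right (mul_angle_deriv_pos ha.ne' ht) ha.le
  · simp only [angle_eq]
    exact (tendsto_angle_sub a).add_atTop (tendsto_id.const_mul_atTop ha)

theorem angle_of_neg {a : ℝ} (ha : a < 0) :
    StrictAntiOn (fun t => (traceLog a t).im) (Ici 0) ∧
      Tendsto (fun t => (traceLog a t).im) atTop atBot := by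
  constructor
  · refine strictAntiOn_of_deriv_neg (convex_Ici 0)
      (isPolarForm_trace a).angle_continuousOn fun t ht => ?_
    rw [interior_Ici] at ht
    rw [(hasDerivAt_angle a ht).deriv]
    exact neg_of_mul_pos_right (mul_angle_deriv_pos ha.ne ht) ha.le
  · simp only [angle_eq]
    exact (tendsto_angle_sub a).add_atBot (tendsto_id.const_mul_atTop_of_neg ha)

theorem angle_zero {t : ℝ} (ht : 0 ≤ t) : (traceLog 0 t).im = 0 := by
  -- By reflection the trace is real, so the angle has zero derivative.
  have hd : ∀ s, 0 < s → HasDerivAt (fun t => (traceLog 0 t).im) 0 s := fun s hs => by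
    refine (hasDerivAt_angle 0 hs).congr_deriv ?_
    have h1 := trace_neg 0 hs.le
    rw [neg_zero] at h1
    obtain ⟨x, hx⟩ := Complex.conj_eq_iff_real.mp h1.symm
    have h2 : ((1 + x) / (1 - x) : ℂ) = ((1 + x) / (1 - x) : ℝ) := by push_cast; rfl
    rw [hx, h2, Complex.ofReal_im, sub_zero]
  rcases ht.eq_or_lt with rfl | h
  · simp [traceLog_zero]
  · obtain ⟨c, -, hc⟩ := exists_hasDerivAt_eq_slope (fun t => (traceLog 0 t).im) (fun _ => 0) h
      ((isPolarForm_trace 0).angle_continuousOn.mono Icc_subset_Ici_self) fun s hs => hd s hs.1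
    rw [traceLog_zero, Complex.zero_im, sub_zero, sub_zero, eq_comm, div_eq_zero_iff] at hc
    exact hc.resolve_right h.ne'

end Spiroid

theorem mainTheorem6 (a : ℝ) :
    Spiroid.IsSpirallike (Spiroid.arccot a - Real.pi / 2) (Spiroid.phi a) ∧
    (∃ f : ℂ → ℝ → ℂ, Spiroid.IsLoewnerFlow (Spiroid.driving a) f) ∧
    ∀ f : ℂ → ℝ → ℂ, Spiroid.IsLoewnerFlow (Spiroid.driving a) f →
      Spiroid.IsDecreasingChain f ∧
      -- the formula for the flow
      (∀ z ∈ Spiroid.disc, ∀ t : ℝ, 0 ≤ t →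
        Complex.exp ((Complex.I * a - 1) * t) *
            Spiroid.phi a (Complex.exp (-(Complex.I * a * t)) * z) ∈
          Spiroid.phi a '' Spiroid.disc ∧
        f z t = Function.invFunOn (Spiroid.phi a) Spiroid.disc
          (Complex.exp ((Complex.I * a - 1) * t) *
            Spiroid.phi a (Complex.exp (-(Complex.I * a * t)) * z))) ∧
      -- the trace
      ∃ γ : ℝ → ℂ, Spiroid.IsTrace (Spiroid.driving a) f γ ∧
        (∀ t : ℝ, 0 < t → γ t ∈ Spiroid.disc) ∧
        Spiroid.IsSmoothCurve γ ∧
        Spiroid.StartsPerpendicularly γ ∧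
        (∃ r Θ : ℝ → ℝ, Spiroid.IsPolarForm γ r Θ ∧
          (0 < a → StrictMonoOn Θ (Set.Ici 0) ∧ Filter.Tendsto Θ Filter.atTop Filter.atTop) ∧
          (a < 0 → StrictAntiOn Θ (Set.Ici 0) ∧ Filter.Tendsto Θ Filter.atTop Filter.atBot) ∧
          (a = 0 → ∀ t : ℝ, 0 ≤ t → Θ t = 0)) ∧
        -- reflection in the real line
        (∀ (g : ℂ → ℝ → ℂ) (δ : ℝ → ℂ), Spiroid.IsLoewnerFlow (Spiroid.driving (-a)) g →
          Spiroid.IsTrace (Spiroid.driving (-a)) g δ →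
          ∀ t : ℝ, 0 ≤ t → δ t = (starRingEnd ℂ) (γ t)) := by
  refine ⟨Spiroid.isSpirallike_phi a, ⟨Spiroid.flow a, Spiroid.isLoewnerFlow_flow a⟩,
    fun f hf => ⟨(Spiroid.isDecreasingChain_flow a).congr fun z hz t ht => hf.eq_flow hz ht,
      fun z hz t ht => ?_, Spiroid.trace a, Spiroid.isTrace_trace hf,
      fun t ht => Spiroid.trace_mem a ht, Spiroid.isSmoothCurve_trace a,
      Spiroid.startsPerpendicularly_trace a, ⟨_, _, Spiroid.isPolarForm_trace a,
        Spiroid.angle_of_pos, Spiroid.angle_of_neg, ?_⟩, fun g δ hg hδ t ht => ?_⟩⟩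
  · rw [Spiroid.exp_neg_eq_inv_driving]
    exact ⟨Spiroid.flow_arg_mem a hz ht, hf.eq_flow hz ht⟩
  · rintro rfl t ht
    exact Spiroid.angle_zero ht
  · rw [hδ.eq (Spiroid.isTrace_trace hg) ht, Spiroid.trace_neg a ht]
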